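/- Let $p\ge 2$ and $N\ge 1$. A real tensor $\mathcal T=(\mathcal T_{i_1\ldots i_p})_{1\le i_1,\ldots,i_p\le N}$ is symmetric if $\mathcal T_{i_1\ldots i_p}=\mathcal T_{i_{s(1)}\ldots i_{s(p)}}$ for every permutation $s$ of $\{1,\ldots,p\}$. A $p$-regular combinatorial map $b=(\sigma,\tau)$ with $n$ vertices consists of two permutations of a set of $np$ halfedges, where all cycles of $\sigma$ have length $p$ and $\tau$ is an involution without fixed points; its vertices $V(b)$ are the cycles of $\sigma$, its edges $E(b)$ are the cycles of $\tau$, and it is connected if the multigraph formed by these vertices and edges is connected. It is rooted if a halfedge is marked. For $n\ge1$ let $\mathcal B_n^{(p)}$ be the set of rooted connected $p$-regular combinatorial maps with $n$ vertices, up to relabelling of the halfedges (preserving the root). The trace invariant of a symmetric tensor $\mathcal T$ associated to $b$ is $$\mathrm{Tr}_b(\mathcal T)=\sum_{a\colon E(b)\to\{1,\ldots,N\}}\ \prod_{v\in V(b)}\mathcal T_{a(\delta(v)_1)\ldots a(\delta(v)_p)},$$ where $\delta(v)_1,\ldots,\delta(v)_p$ are the edges of the successive halfedges around $v$. Put $I_0(\mathcal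 T)=N$ and $I_n(\mathcal T)=\sum_{b\in\mathcal B_n^{(p)}}\mathrm{Tr}_b(\mathcal T)$ for $n\ge1$. A sequence of Wigner tensors of order $p$ is a sequence $\mathcal W_N=\mathcal T_N/N^{(p-1)/2}$, $N\ge1$, where $\mathcal T_N$ is a random real symmetric tensor of order $p$ and dimension $N$ such that the entries $(\mathcal T_N)_{i_1\ldots i_p}$ with $i_1\le\ldots\le i_p$ are independent; all entries are centered and have finite moments of all orders; for every $k$ the $k$-th absolute moments of the entries are bounded uniformly in the entry and in $N$; and $\mathbb E[(\mathcal T_N)_{i_1\ldots i_p}^2]=\frac1{(p-1)!}$ whenever $i_1,\ldots,i_p$ are pairwise distinct. Theorem. Let $p\ge2$ and let $(\mathcal W_N)_{N\ge1}$ be a sequence of Wigner tensors of order $p$. Then for every $n\ge0$ the random variable $\frac1N I_n(\mathcal W_N)$ is integrable for every $N\ge 1$ and, as $N\to\infty$, $$\mathbb E\Big[\frac1N I_n(\mathcal W_N)\Big]=\mathbb 1_{n\text{ even}}\,F_p\Big(\frac n2\Big)+\mathcal O\Big(\frac1N\Big),\qquad F_p(k)=\frac1{pk+1}\binom{pk+1}{k}.$$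 -/

import Mathlib

open MeasureTheory ProbabilityTheory Filter Asymptotics

noncomputable section

namespace WignerTensor

/-- The space `𝒮_p(N)` of real symmetric tensors of order `p` and dimension `N`. -/
def SymTensor (p N : ℕ) : Submodule ℝ ((Fin p → Fin N) → ℝ) where
  carrier := {T | ∀ (i : Fin p → Fin N) (s : Equiv.Perm (Fin p)), T (i ∘ s) = T i}
  add_mem' := fun {S T} hS hT i s => by
    simp only [Pi.add_apply, hS i s, hT i s]
  zero_mem' := fun _ _ => rfl
  smul_mem' := fun c T hT i s => by
    simp only [Pi.smul_apply, hT i s]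

/-- A combinatorial map on the set `Q` of halfedges: a permutation `σ` and a fixed-point-free
involution `τ`. -/
structure CombMap (Q : Type) where
  σ : Equiv.Perm Q
  τ : Equiv.Perm Q
  τ_invol : ∀ q, τ (τ q) = q
  τ_ne : ∀ q, τ q ≠ q

namespace CombMap

variable {Q : Type}

/-- The vertices: cycles of `σ` (fixed points of `σ` being cycles of length one). -/
def Vertex (b : CombMap Q) : Type := Quotient (Equiv.Perm.SameCycle.setoid b.σ)

/-- The edges: cycles of `τ`. -/
def Edge (b : CombMap Q) : Type := Quotient (Equiv.Perm.SameCycle.setoid b.τ)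

/-- The vertex carrying a halfedge. -/
def vertexOf (b : CombMap Q) (q : Q) : b.Vertex :=
  Quotient.mk (Equiv.Perm.SameCycle.setoid b.σ) q

/-- A halfedge of the vertex `v`. -/
def rep (b : CombMap Q) (v : b.Vertex) : Q :=
  @Quotient.out _ (Equiv.Perm.SameCycle.setoid b.σ) v

theorem vertexOf_rep (b : CombMap Q) (v : b.Vertex) : b.vertexOf (b.rep v) = v :=
  @Quotient.out_eq _ (Equiv.Perm.SameCycle.setoid b.σ) v

/-- The edge containing a halfedge. -/
def edgeOf (b : CombMap Q) (q : Q) : b.Edge :=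
  Quotient.mk (Equiv.Perm.SameCycle.setoid b.τ) q

instance [Finite Q] (b : CombMap Q) : Fintype b.Vertex :=
  @Fintype.ofFinite _ (inferInstanceAs (Finite (Quotient (Equiv.Perm.SameCycle.setoid b.σ))))

instance [Finite Q] (b : CombMap Q) : Fintype b.Edge :=
  @Fintype.ofFinite _ (inferInstanceAs (Finite (Quotient (Equiv.Perm.SameCycle.setoid b.τ))))

instance (b : CombMap Q) : DecidableEq b.Edge := Classical.decEq _

/-- All cycles of `σ` have length `p`. -/
def IsRegular (b : CombMap Q) (p : ℕ) : Prop :=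
  ∀ q, Function.minimalPeriod b.σ q = p

/-- The graph `G(b)`, up to loops and multiplicities of edges (irrelevant for connectedness). -/
def graph (b : CombMap Q) : SimpleGraph b.Vertex :=
  SimpleGraph.fromRel fun u v => ∃ q, b.vertexOf q = u ∧ b.vertexOf (b.τ q) = v

/-- The trace invariant `Tr_b(T)`: sum over all labellings of the edges by indices of the product
over the vertices of the corresponding entries of `T`. The halfedges around the vertex `v` are
listed in their cyclic order, starting from an arbitrary one; the starting point does not matter
as `T` is symmetric. -/
def trace [Finite Q] {p N : ℕ} (b : CombMap Q) (T : SymTensor p N) : ℝ :=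
  ∑ a : b.Edge → Fin N, ∏ v : b.Vertex,
    T.1 fun k : Fin p => a (b.edgeOf ((b.σ ^ (k : ℕ)) (b.rep v)))

instance [Finite Q] : Finite (CombMap Q) :=
  Finite.of_injective (fun b : CombMap Q => (b.σ, b.τ)) fun b c h => by
    cases b; cases c; simp_all

/-- `θ` is a relabelling of the halfedges turning `b` into `c`. -/
def IsRelabelling (θ : Equiv.Perm Q) (b c : CombMap Q) : Prop :=
  c.σ = θ * b.σ * θ⁻¹ ∧ c.τ = θ * b.τ * θ⁻¹

theorem IsRelabelling.trans {θ η : Equiv.Perm Q} {b c d : CombMap Q}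
    (h : IsRelabelling θ b c) (h' : IsRelabelling η c d) : IsRelabelling (η * θ) b d := by
  refine ⟨?_, ?_⟩
  · rw [h'.1, h.1]; group
  · rw [h'.2, h.2]; group

theorem IsRelabelling.symm {θ : Equiv.Perm Q} {b c : CombMap Q}
    (h : IsRelabelling θ b c) : IsRelabelling θ⁻¹ c b := by
  refine ⟨?_, ?_⟩
  · rw [h.1]; group
  · rw [h.2]; group

theorem apply_eq_of_sameCycle {p N : ℕ} (T : SymTensor p N) (s : Equiv.Perm Q) {q q' : Q}
    (hp : Function.minimalPeriod s q = p) [Finite Q] (h : s.SameCycle q q') (f : Q → Fin N) :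
    T.1 (fun k : Fin p => f ((s ^ (k : ℕ)) q')) = T.1 (fun k : Fin p => f ((s ^ (k : ℕ)) q)) := by
  obtain ⟨m, rfl⟩ := h.exists_nat_pow_eq
  rcases p with _ | p
  · exact congrArg T.1 (funext fun k => k.elim0)
  rw [← T.2 (fun k : Fin (p + 1) => f ((s ^ (k : ℕ)) q)) (Equiv.addRight (Fin.ofNat (p + 1) m))]
  refine congrArg T.1 (funext fun k => ?_)
  simp only [Function.comp_apply, Equiv.coe_addRight, ← Equiv.Perm.mul_apply, ← pow_add]
  congr 1
  have hv : ((k + Fin.ofNat (p + 1) m : Fin (p + 1)) : ℕ) = ((k : ℕ) + m) % (p + 1) := by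
    rw [Fin.val_add]; simp [Fin.ofNat]
  have hit := Function.iterate_mod_minimalPeriod_eq (f := s) (x := q) (n := (k : ℕ) + m)
  rw [hp] at hit
  rw [hv, Equiv.Perm.coe_pow, Equiv.Perm.coe_pow, hit]

theorem trace_eq_of_isRelabelling [Finite Q] {p N : ℕ} {θ : Equiv.Perm Q} {b c : CombMap Q}
    (hb : b.IsRegular p) (h : IsRelabelling θ b c) (T : SymTensor p N) :
    b.trace T = c.trace T := by
  let eV : b.Vertex ≃ c.Vertex := Quotient.congr θ fun x y => by
    change b.σ.SameCycle x y ↔ c.σ.SameCycle (θ x) (θ y)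
    rw [h.1, Equiv.Perm.sameCycle_conj]; simp
  let eE : b.Edge ≃ c.Edge := Quotient.congr θ fun x y => by
    change b.τ.SameCycle x y ↔ c.τ.SameCycle (θ x) (θ y)
    rw [h.2, Equiv.Perm.sameCycle_conj]; simp
  unfold trace
  refine Fintype.sum_equiv (Equiv.arrowCongr eE (Equiv.refl _)) _ _ fun a => ?_
  refine Fintype.prod_equiv eV _ _ fun v => ?_
  have hpow : ∀ (k : ℕ) (q : Q), (c.σ ^ k) q = θ ((b.σ ^ k) (θ⁻¹ q)) := by
    intro k q
    rw [h.1, conj_pow]; rfl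
  have hE : ∀ q, eE.symm (c.edgeOf (θ q)) = b.edgeOf q := by
    intro q
    rw [Equiv.symm_apply_eq]; rfl
  have hV : b.σ.SameCycle (b.rep v) (θ⁻¹ (c.rep (eV v))) := by
    have h1 : c.vertexOf (θ (b.rep v)) = c.vertexOf (c.rep (eV v)) := by
      rw [vertexOf_rep]
      exact congrArg eV (b.vertexOf_rep v)
    have h2 : c.σ.SameCycle (θ (b.rep v)) (c.rep (eV v)) := Quotient.exact h1
    generalize c.rep (eV v) = q at h2 ⊢
    rw [h.1, Equiv.Perm.sameCycle_conj] at h2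
    simpa using h2
  simp only [Equiv.arrowCongr_apply, Equiv.coe_refl, Function.comp_apply, id_eq, hpow, hE]
  exact (apply_eq_of_sameCycle T b.σ (hb _) hV fun q => a (b.edgeOf q)).symm

end CombMap

/-- Rooted connected `p`-regular combinatorial maps with `n` vertices, with halfedges labelled by
`Fin (n * p)`: the number of halfedges of a `p`-regular map with `n` vertices is `n * p`. -/
structure RootedMap (p n : ℕ) where
  map : CombMap (Fin (n * p))
  root : Fin (n * p)
  regular : map.IsRegular p
  connected : map.graph.Connected

/-- Equality of rooted maps up to relabelling of the halfedges. -/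
instance RootedMap.setoid (p n : ℕ) : Setoid (RootedMap p n) where
  r b c := ∃ θ : Equiv.Perm (Fin (n * p)),
    CombMap.IsRelabelling θ b.map c.map ∧ θ b.root = c.root
  iseqv :=
    { refl := fun b => ⟨1, ⟨by simp, by simp⟩, rfl⟩
      symm := fun {b c} ⟨θ, h, hr⟩ => ⟨θ⁻¹, h.symm, by rw [← hr]; simp⟩
      trans := fun {b c d} ⟨θ, h, hr⟩ ⟨η, h', hr'⟩ =>
        ⟨η * θ, h.trans h', by rw [Equiv.Perm.mul_apply, hr, hr']⟩ }

/-- The set `ℬ_n^{(p)}` of unlabelled rooted connected `p`-regular maps with `n` vertices. -/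
def UnlabelledMap (p n : ℕ) : Type := Quotient (RootedMap.setoid p n)

instance (p n : ℕ) : Finite (RootedMap p n) :=
  Finite.of_injective (fun b : RootedMap p n => (b.map, b.root)) fun b c h => by
    cases b; cases c; simp_all

instance (p n : ℕ) : Fintype (UnlabelledMap p n) :=
  @Fintype.ofFinite _ (inferInstanceAs (Finite (Quotient (RootedMap.setoid p n))))

/-- The trace invariant of an unlabelled map. -/
def UnlabelledMap.trace {p n N : ℕ} (b : UnlabelledMap p n) (T : SymTensor p N) : ℝ :=
  Quotient.lift (fun b : RootedMap p n => b.map.trace T)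
    (fun b c (hbc : (RootedMap.setoid p n).r b c) =>
      hbc.elim fun _ h => CombMap.trace_eq_of_isRelabelling b.regular h.1 T) b

/-- The balanced single trace invariant `I_n(T)`, with the convention `I_0(T) = N`. -/
def balancedTrace {p N : ℕ} (n : ℕ) (T : SymTensor p N) : ℝ :=
  if n = 0 then (N : ℝ) else ∑ b : UnlabelledMap p n, b.trace T

/-- The Fuss–Catalan number `F_p(k)`. -/
def fussCatalan (p k : ℕ) : ℝ := 1 / ((p : ℝ) * k + 1) * ((p * k + 1).choose k : ℝ)

/-- The unnormalized random symmetric tensor: the entries are centered with finite moments of all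
orders, independent up to symmetry (i.e. the entries with `i₁ ≤ … ≤ i_p` are independent), and the
entries whose indices are pairwise distinct have variance `1 / (p - 1)!`. -/
structure HasWignerEntries {Ω : Type*} [MeasurableSpace Ω] {p N : ℕ} (P : Measure Ω)
    (T : Ω → SymTensor p N) : Prop where
  measurable : ∀ i, Measurable fun ω => (T ω).1 i
  indep : iIndepFun
    (fun (i : {i : Fin p → Fin N // Monotone i}) (ω : Ω) => (T ω).1 i.1) P
  moments : ∀ i (k : ℕ), Integrable (fun ω => |(T ω).1 i| ^ k) P
  centered : ∀ i, ∫ ω, (T ω).1 i ∂P = 0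
  variance : ∀ i, Function.Injective i →
    ∫ ω, (T ω).1 i ^ 2 ∂P = 1 / ((p - 1).factorial : ℝ)

/-- The normalized tensor `T / N^{(p-1)/2}`. -/
def normalize {p N : ℕ} (T : SymTensor p N) : SymTensor p N :=
  ((N : ℝ) ^ (((p : ℝ) - 1) / 2))⁻¹ • T

/-- `(W_N)` is a sequence of Wigner tensors of order `p`: each `W_N`, `N ≥ 1`, is the normalization
of a random symmetric tensor `T_N` as in `HasWignerEntries`, the moments of the entries of `T_N`
being bounded uniformly in the entry and in `N`. -/
def IsWignerSequence {p : ℕ} {Ω : ℕ → Type*} [∀ N, MeasurableSpace (Ω N)]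
    (P : ∀ N, Measure (Ω N)) (W : ∀ N, Ω N → SymTensor p N) : Prop :=
  ∃ T : ∀ N, Ω N → SymTensor p N,
    (∀ N, 1 ≤ N → HasWignerEntries (P N) (T N)) ∧
    (∀ k : ℕ, ∃ C : ℝ, ∀ N, 1 ≤ N → ∀ i, ∫ ω, |(T N ω).1 i| ^ k ∂(P N) ≤ C) ∧
    ∀ N, 1 ≤ N → ∀ ω, W N ω = normalize (T N ω)

end WignerTensor

end

/-! A connected map has no nontrivial relabelling that fixes its root. Each unlabelled rooted map
therefore has exactly (np)! labelled representatives, and I_n is np/(np)! times a sum over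
permutations σ with all cycles of length p, over matchings τ of the halfedges that connect the
cycles, and over labellings of the halfedges preserved by τ (`balancedTrace_eq`). The halfedges form
an array of n rows of length p, one row per vertex, and the expectation of a product of entries
depends only on the labels of the rows.

Since the entries are independent and centered, a labelling contributes only if each row agrees with
another row up to permutation. Let K ≤ n/2 be the number of classes of rows for this relation. As τ
connects the rows, the label sets of the classes can be added one at a time, each meeting an earlier
one, so at most 1 + K(p-1) labels occur. In the case of equality each set has p elements and, when
added after the first one, exactly one old label; a parity argument then shows that every class has
even size (`Chained.of_card_eq`, `RowClasses.of_card_eq`). Consequently at most k(p-1) labels occur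
if n = 2k+1. If n = 2k and more than k(p-1) labels occur, the rows come in k pairs, have distinct
labels, and the moment is exactly (1/(p-1)!)^k. The remaining labellings number O(N^{k(p-1)}) and
only enter the error term.

For the leading term, the moment is replaced by the number of ways to pair the rows and align them
by permutations (`wickSum`). All (2k-1)!! p!^k choices contribute equally: each counts matchings of
two copies of a k × p array together with labellings of a single copy. Deleting one point of the
array at a time gives a recursion for this count, valid for arbitrary blocks in place of rows
(`labelCount_option`), and its leading coefficient has a closed form (`blockCoeff`,
`labelCount_isBigO`). Multiplied by the number of admissible σ, it simplifies to
(pk)(pk-1)⋯(pk-k+2)/k!, which is the Fuss–Catalan number (`fussCatalan_eq`). -/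

noncomputable section

namespace WignerTensor

/-! ### Perfect matchings and the insertion of two points. -/

section

/-- Perfect matchings of a type, as involutions without fixed points. -/
def Matching (Y : Type) : Type := {f : Y → Y // Function.Involutive f ∧ ∀ y, f y ≠ y}

namespace Matching

variable {X Y Z ι κ : Type}

instance [Finite Y] : Fintype (Matching Y) :=
  @Fintype.ofFinite _ (inferInstanceAs (Finite {f : Y → Y // Function.Involutive f ∧ ∀ y, f y ≠ y}))

/-- Matched points have equal images under `h`. -/
def Preserves (τ : Matching Y) (h : Y → Z) : Prop := ∀ y, h (τ.1 y) = h y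

/-- The graph on `ι` with an edge between the images under `β` of any two matched points is
connected. -/
def Connects (τ : Matching Y) (β : Y → ι) : Prop :=
  ∀ f : ι → Bool, τ.Preserves (f ∘ β) → ∀ i j, f i = f j

/-- Transport of matchings along an equivalence. -/
def congr (e : Y ≃ Z) : Matching Y ≃ Matching Z where
  toFun τ := ⟨fun z => e (τ.1 (e.symm z)), fun z => by simp [τ.2.1 _], fun z h => by
    rw [← Equiv.eq_symm_apply] at h; exact τ.2.2 _ h⟩
  invFun τ := ⟨fun z => e.symm (τ.1 (e z)), fun z => by simp [τ.2.1 _], fun z h => by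
    rw [Equiv.symm_apply_eq] at h; exact τ.2.2 _ h⟩
  left_inv τ := Subtype.ext (funext fun z => by simp)
  right_inv τ := Subtype.ext (funext fun z => by simp)

theorem congr_apply (e : Y ≃ Z) (τ : Matching Y) (z : Z) :
    (congr e τ).1 z = e (τ.1 (e.symm z)) := rfl

theorem congr_preserves {W : Type} (e : Y ≃ Z) (τ : Matching Y) (h : Z → W) :
    (congr e τ).Preserves h ↔ τ.Preserves (h ∘ e) := by
  constructor
  · intro H y; simpa [congr_apply] using H (e y)
  · intro H z; simpa [congr_apply] using H (e.symm z)

theorem congr_connects (e : Y ≃ Z) (τ : Matching Y) (β : Z → ι) :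
    (congr e τ).Connects β ↔ τ.Connects (β ∘ e) := by
  simp only [Connects, congr_preserves, Function.comp_assoc]

/-- Connectedness passes to quotients of the index set. -/
theorem Connects.comp {τ : Matching Y} {β : Y → ι} (h : τ.Connects β) (g : ι → κ)
    (hg : Function.Surjective g) : τ.Connects (g ∘ β) := by
  intro f hf i j
  obtain ⟨i, rfl⟩ := hg i
  obtain ⟨j, rfl⟩ := hg j
  exact h (f ∘ g) hf i j

open Classical in
/-- Insertion of two new points into a matching: they are matched together, or they are inserted
into the edge of `r`, the first one being matched to `r`. -/
def insertPair : Option Y → Matching Y → Matching (Y ⊕ Bool)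
  | none, τ => ⟨Sum.elim (fun y => Sum.inl (τ.1 y)) (fun b => Sum.inr (!b)),
      by rintro (y | b) <;> simp [τ.2.1 _],
      by rintro (y | b) <;> simp [τ.2.2 _]⟩
  | some r, τ => ⟨Sum.elim
      (fun y => if y = r then Sum.inr true else if y = τ.1 r then Sum.inr false
        else Sum.inl (τ.1 y))
      (fun b => if b then Sum.inl r else Sum.inl (τ.1 r)),
      by
        have h1 := τ.2.1
        have h2 := τ.2.2
        have h3 : ∀ y, τ.1 y = r ↔ y = τ.1 r := fun y => h1.eq_iff
        have h4 : ∀ y, τ.1 y = τ.1 r ↔ y = r := fun y => h1.injective.eq_iff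
        rintro (y | b)
        · by_cases hy : y = r
          · simp [hy]
          · by_cases hy' : y = τ.1 r
            · simp [hy', h2]
            · simp [hy, hy', h3, h4, h1 y]
        · cases b <;> simp [h2],
      by
        rintro (y | b)
        · by_cases hy : y = r
          · simp [hy]
          · by_cases hy' : y = τ.1 r
            · simp [hy', τ.2.2]
            · simp [hy, hy', τ.2.2]
        · cases b <;> simp⟩

/-- The insertion can be read off from the partners of the two new points: they are matched
together, or they are matched to `r` and to the former partner of `r`. -/
theorem insertPair_injective :
    Function.Injective fun q : Option Y × Matching Y => insertPair q.1 q.2 := by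
  rintro ⟨c, τ⟩ ⟨d, τ'⟩ h
  have h : ∀ z, (insertPair c τ).1 z = (insertPair d τ').1 z := fun z =>
    congrFun (congrArg Subtype.val h) z
  cases c with
  | none =>
    cases d with
    | none =>
      have : τ = τ' := Subtype.ext (funext fun y => by simpa [insertPair] using h (Sum.inl y))
      rw [this]
    | some r => have := h (Sum.inr true); simp [insertPair] at this
  | some r =>
    cases d with
    | none => have := h (Sum.inr true); simp [insertPair] at this
    | some r' =>
      have h1 : r = r' := by simpa [insertPair] using h (Sum.inr true)
      subst h1
      have h2 : τ.1 r = τ'.1 r := by simpa [insertPair] using h (Sum.inr false)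
      have : τ = τ' := Subtype.ext (funext fun y => by
        by_cases hy : y = r
        · rw [hy, h2]
        · by_cases hy' : y = τ.1 r
          · rw [hy', τ.2.1, h2, τ'.2.1]
          · simpa [insertPair, hy, hy', ← h2] using h (Sum.inl y))
      rw [this]

/-- The inverse operation deletes the two new points and, if they were not matched together, matches
their former partners with each other. -/
theorem insertPair_surjective :
    Function.Surjective fun q : Option Y × Matching Y => insertPair q.1 q.2 := by
  classical
  intro τ
  have h1 := τ.2.1
  have h2 := τ.2.2
  rcases hc : τ.1 (Sum.inr true) with r | b
  · rcases hd : τ.1 (Sum.inr false) with s | b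
    · have hr : τ.1 (Sum.inl r) = Sum.inr true := by rw [← hc, h1]
      have hs : τ.1 (Sum.inl s) = Sum.inr false := by rw [← hd, h1]
      have hrs : r ≠ s := by rintro rfl; rw [hr] at hs; simp at hs
      have key : ∀ y, y ≠ r → y ≠ s → ∃ z, τ.1 (Sum.inl y) = Sum.inl z ∧ z ≠ r ∧ z ≠ s := by
        intro y hyr hys
        rcases hz : τ.1 (Sum.inl y) with z | b
        · refine ⟨z, rfl, ?_, ?_⟩
          · rintro rfl
            have := h1 (Sum.inl y); rw [hz, hr] at this; simp at this
          · rintro rfl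
            have := h1 (Sum.inl y); rw [hz, hs] at this; simp at this
        · have := h1 (Sum.inl y)
          rw [hz] at this
          cases b
          · rw [hd] at this; simp at this; exact absurd this.symm hys
          · rw [hc] at this; simp at this; exact absurd this.symm hyr
      -- `r` and `s` are the partners of the deleted points; everywhere else `τ` already stays
      -- inside `Y`.
      let g : Y → Y := fun y => if h : y = r then s else if h' : y = s then r else
        (key y h h').choose
      have gr : g r = s := by simp [g]
      have gs : g s = r := by simp [g, hrs.symm]
      have gy : ∀ y, y ≠ r → y ≠ s → τ.1 (Sum.inl y) = Sum.inl (g y) ∧ g y ≠ r ∧ g y ≠ s := by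
        intro y hy hy'
        simp only [g, hy, hy', dite_false]
        exact (key y hy hy').choose_spec
      refine ⟨(some r, ⟨g, ?_, ?_⟩), ?_⟩
      · intro y
        by_cases hy : y = r
        · rw [hy, gr, gs]
        · by_cases hy' : y = s
          · rw [hy', gs, gr]
          · obtain ⟨e1, e2, e3⟩ := gy y hy hy'
            obtain ⟨e4, -, -⟩ := gy _ e2 e3
            rw [← e1, h1] at e4
            simpa using e4.symm
      · intro y
        by_cases hy : y = r
        · rw [hy, gr]; exact hrs.symm
        · by_cases hy' : y = s
          · rw [hy', gs]; exact hrs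
          · intro e
            obtain ⟨e1, e2, e3⟩ := gy y hy hy'
            rw [e] at e1
            exact h2 _ e1
      · refine Subtype.ext (funext ?_)
        rintro (y | b)
        · by_cases hy : y = r
          · simp [insertPair, hy, hr]
          · by_cases hy' : y = s
            · simp [insertPair, hy', gr, hs, hrs.symm]
            · simp [insertPair, hy, hy', gr, (gy y hy hy').1]
        · cases b <;> simp [insertPair, hc, hd, gr]
    · exfalso
      have := h1 (Sum.inr false)
      rw [hd] at this
      cases b
      · exact h2 _ hd
      · rw [hc] at this; simp at this
  · have hb : b = false := by
      cases b
      · rfl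
      · exact absurd hc (h2 _)
    subst hb
    have hd : τ.1 (Sum.inr false) = Sum.inr true := by rw [← hc, h1]
    have key : ∀ y, ∃ z, τ.1 (Sum.inl y) = Sum.inl z := by
      intro y
      rcases hz : τ.1 (Sum.inl y) with z | b
      · exact ⟨z, rfl⟩
      · have := h1 (Sum.inl y)
        rw [hz] at this
        cases b
        · rw [hd] at this; simp at this
        · rw [hc] at this; simp at this
    choose g hg using key
    refine ⟨(none, ⟨g, fun y => ?_, fun y h => ?_⟩), ?_⟩
    · have := h1 (Sum.inl y)
      rw [hg, hg] at this
      simpa using this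
    · have := hg y
      rw [h] at this
      exact h2 _ this
    · refine Subtype.ext (funext ?_)
      rintro (y | b)
      · simp [insertPair, hg]
      · cases b <;> simp [insertPair, hc, hd]

/-- A matching of `Y ⊕ Bool` is obtained from a unique matching of `Y` by a unique insertion. -/
def insertPairEquiv (Y : Type) : Option Y × Matching Y ≃ Matching (Y ⊕ Bool) :=
  Equiv.ofBijective _ ⟨insertPair_injective, insertPair_surjective⟩

theorem insertPair_none_preserves (τ : Matching Y) (h : Y ⊕ Bool → Z)
    (hh : h (Sum.inr true) = h (Sum.inr false)) :
    (insertPair none τ).Preserves h ↔ τ.Preserves (h ∘ Sum.inl) := by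
  simp [Preserves, insertPair, Sum.forall, hh]

/-- Both new points sit on the former edge of `r` and share a value of `h`, so this value propagates
from one end of that edge to the other. -/
theorem insertPair_some_preserves (r : Y) (τ : Matching Y) (h : Y ⊕ Bool → Z)
    (hh : h (Sum.inr true) = h (Sum.inr false)) :
    (insertPair (some r) τ).Preserves h ↔
      h (Sum.inr true) = h (Sum.inl r) ∧ τ.Preserves (h ∘ Sum.inl) := by
  constructor
  · intro H
    have e1 : h (Sum.inl r) = h (Sum.inr true) := by simpa [insertPair] using H (Sum.inr true)
    have e2 : h (Sum.inl (τ.1 r)) = h (Sum.inr false) := by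
      simpa [insertPair] using H (Sum.inr false)
    refine ⟨e1.symm, fun y => ?_⟩
    by_cases hy : y = r
    · simp [hy, e1, e2, hh]
    · by_cases hy' : y = τ.1 r
      · simp [hy', τ.2.1 r, e1, e2, hh]
      · simpa [insertPair, hy, hy'] using H (Sum.inl y)
  · rintro ⟨e1, H⟩
    have e2 : h (Sum.inl (τ.1 r)) = h (Sum.inl r) := H r
    rintro (y | b)
    · by_cases hy : y = r
      · simp [insertPair, hy, e1]
      · by_cases hy' : y = τ.1 r
        · simp [insertPair, hy', τ.2.2, ← hh, e1, e2]
        · simpa [insertPair, hy, hy'] using H y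
    · cases b <;> simp [insertPair, ← hh, e1, e2]

theorem card_sum_bool [Fintype Y] :
    Fintype.card (Matching (Y ⊕ Bool)) = (Fintype.card Y + 1) * Fintype.card (Matching Y) := by
  rw [← Fintype.card_congr (insertPairEquiv Y), Fintype.card_prod, Fintype.card_option]

/-- This is (2k-1)!! = (2k)!/(2^k k!) without division: two further points can be inserted into a
matching of 2k points in 2k + 1 ways. -/
theorem card_mul (k : ℕ) [Fintype Y] (h : Fintype.card Y = 2 * k) :
    Fintype.card (Matching Y) * (2 ^ k * k.factorial) = (2 * k).factorial := by
  induction k generalizing Y with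
  | zero =>
    have : IsEmpty Y := Fintype.card_eq_zero_iff.1 (by simpa using h)
    have : Unique (Matching Y) :=
      { default := ⟨isEmptyElim, fun y => isEmptyElim y, fun y => isEmptyElim y⟩
        uniq := fun τ => Subtype.ext (funext fun y => isEmptyElim y) }
    simp
  | succ k ih =>
    have e : Y ≃ Fin (2 * k) ⊕ Bool := Fintype.equivOfCardEq (by simp [h]; ring)
    rw [Fintype.card_congr (congr e), card_sum_bool]
    have := ih (Y := Fin (2 * k)) (by simp)
    rw [Fintype.card_fin, show 2 * (k + 1) = 2 * k + 1 + 1 by ring, Nat.factorial_succ (2 * k + 1),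
      Nat.factorial_succ (2 * k), ← this, Nat.factorial_succ k]
    ring

end Matching

end

/-! ### Counting labellings of a doubled set: the recursion. -/

section

variable {X X' ι : Type}

open Classical in
/-- The number of pairs of a matching of `X × Bool` connecting the blocks of `γ` and of a labelling
of `X` preserved by the matching. -/
def preservedCount [Fintype X] (γ : X × Bool → ι) (N : ℕ) : ℝ :=
  ∑ τ : Matching (X × Bool), ∑ a : X → Fin N,
    if τ.Connects γ ∧ τ.Preserves (a ∘ Prod.fst) then 1 else 0

/-- The number of pairs of a matching of `X × Bool` connecting the blocks of `β` and of a labelling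
of `X` preserved by the matching. -/
def labelCount [Fintype X] (β : X → ι) (N : ℕ) : ℝ := preservedCount (β ∘ Prod.fst) N

theorem labelCount_congr [Fintype X] [Fintype X'] (e : X ≃ X') (β : X' → ι) (N : ℕ) :
    labelCount (β ∘ e) N = labelCount β N := by
  classical
  unfold labelCount preservedCount
  refine Fintype.sum_equiv (Matching.congr (e.prodCongr (Equiv.refl Bool))) _ _ fun τ => ?_
  refine Fintype.sum_equiv (e.arrowCongr (Equiv.refl _)) _ _ fun a => ?_
  rw [Matching.congr_connects, Matching.congr_preserves]
  congr! 3
  ext q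
  simp

/-- The point `none` of `Option X` contributes two points to `Option X × Bool`. -/
def optionProdBoolEquiv (X : Type) : (X × Bool) ⊕ Bool ≃ Option X × Bool where
  toFun := Sum.elim (fun q => (some q.1, q.2)) fun b => (none, b)
  invFun q := q.1.elim (Sum.inr q.2) fun x => Sum.inl (x, q.2)
  left_inv := by rintro (q | b) <;> rfl
  right_inv := by rintro ⟨_ | x, b⟩ <;> rfl

open Classical in
/-- The block `i₀` is merged into the block `j`. -/
def mergeBlocks (β : X → ι) (i₀ : ι) (j : {i // i ≠ i₀}) (x : X) : {i // i ≠ i₀} :=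
  if h : β x = i₀ then j else ⟨β x, h⟩

/-- The two new points lie in the same block, so their common edge is a loop. -/
theorem connects_insertPair_none (β : Option X → ι) (τ : Matching (X × Bool)) :
    (Matching.insertPair none τ).Connects (β ∘ Prod.fst ∘ optionProdBoolEquiv X) ↔
      τ.Connects (β ∘ some ∘ Prod.fst) := by
  unfold Matching.Connects
  refine forall_congr' fun f => ?_
  rw [Matching.insertPair_none_preserves _ _ rfl]
  rfl

theorem connects_insertPair_some_of_eq (β : Option X → ι) (r : X × Bool) (τ : Matching (X × Bool))
    (h : β (some r.1) = β none) :
    (Matching.insertPair (some r) τ).Connects (β ∘ Prod.fst ∘ optionProdBoolEquiv X) ↔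
      τ.Connects (β ∘ some ∘ Prod.fst) := by
  unfold Matching.Connects
  refine forall_congr' fun f => ?_
  rw [Matching.insertPair_some_preserves _ _ _ rfl]
  have : (f ∘ β ∘ Prod.fst ∘ optionProdBoolEquiv X) (Sum.inr true) =
      (f ∘ β ∘ Prod.fst ∘ optionProdBoolEquiv X) (Sum.inl r) := congrArg f h.symm
  simp only [this, true_and]
  rfl

/-- The insertion creates an edge between the block of `none` and that of `r`. From then on, the two
blocks may be identified when testing connectedness. -/
theorem connects_insertPair_some_of_ne (β : Option X → ι) (r : X × Bool) (τ : Matching (X × Bool))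
    (h : β (some r.1) ≠ β none) :
    (Matching.insertPair (some r) τ).Connects (β ∘ Prod.fst ∘ optionProdBoolEquiv X) ↔
      τ.Connects (mergeBlocks (β ∘ some) (β none) ⟨β (some r.1), h⟩ ∘ Prod.fst) := by
  classical
  constructor
  · intro H f hf i j
    -- The removed block receives the value of the block it was merged into.
    let g : ι → Bool := fun i => if h' : i = β none then f ⟨β (some r.1), h⟩ else f ⟨i, h'⟩
    have hg : ∀ i : {i // i ≠ β none}, g i = f i := fun i => by simp [g, i.2]
    rw [← hg, ← hg]
    refine H g ?_ _ _
    rw [Matching.insertPair_some_preserves _ _ _ rfl]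
    refine ⟨?_, ?_⟩
    · simp [optionProdBoolEquiv, g, h]
    · convert hf using 1
      ext q
      simp only [Function.comp_apply, optionProdBoolEquiv, Equiv.coe_fn_mk, Sum.elim_inl, g,
        mergeBlocks]
      by_cases h' : β (some q.1) = β none <;> simp [h']
  · intro H f hf i j
    rw [Matching.insertPair_some_preserves _ _ _ rfl] at hf
    obtain ⟨h1, h2⟩ := hf
    replace h1 : f (β none) = f (β (some r.1)) := h1
    have h3 := H (fun i => f i) (by
      convert h2 using 1
      ext q
      simp only [Function.comp_apply, optionProdBoolEquiv, Equiv.coe_fn_mk, Sum.elim_inl,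
        mergeBlocks]
      split_ifs with h'
      · rw [h', h1]
      · rfl)
    have h4 : ∀ i, f i = f (β (some r.1)) := by
      intro i
      by_cases hi : i = β none
      · rw [hi, h1]
      · exact h3 ⟨i, hi⟩ ⟨_, h⟩
    rw [h4 i, h4 j]

open Classical in
-- The two halfedges above `none` are deleted from the matching. If they were matched together, the
-- label of `none` was free, whence the factor `N`; if they were inserted into the edge of `r`, that
-- label was forced by the label of `r`, and the blocks merge unless they were equal.
theorem labelCount_option [Fintype X] (β : Option X → ι) (N : ℕ) :
    labelCount β N = N * labelCount (β ∘ some) N + ∑ r : X × Bool,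
      if h : β (some r.1) = β none then labelCount (β ∘ some) N
      else labelCount (mergeBlocks (β ∘ some) (β none) ⟨β (some r.1), h⟩) N := by
  have h0 : labelCount β N = ∑ c : Option (X × Bool), ∑ τ : Matching (X × Bool),
      ∑ a : Fin N × (X → Fin N), if
        (Matching.insertPair c τ).Connects (β ∘ Prod.fst ∘ optionProdBoolEquiv X) ∧
        (Matching.insertPair c τ).Preserves
          ((fun o : Option X => o.elim a.1 a.2) ∘ Prod.fst ∘ optionProdBoolEquiv X)
        then (1 : ℝ) else 0 := by
    rw [← Fintype.sum_prod_type']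
    unfold labelCount preservedCount
    symm
    refine Fintype.sum_equiv
      ((Matching.insertPairEquiv _).trans (Matching.congr (optionProdBoolEquiv X))) _ _ fun q => ?_
    refine @Fintype.sum_equiv _ _ _ (_) (_) _
      (Equiv.piOptionEquivProd (β := fun _ => Fin N)).symm _ _ fun a => ?_
    rw [Equiv.trans_apply, Matching.congr_connects, Matching.congr_preserves]
    have : ((Equiv.piOptionEquivProd (β := fun _ => Fin N)).symm a) =
        fun o : Option X => o.elim a.1 a.2 := by
      ext o; cases o <;> rfl
    rw [this]
    rfl
  rw [h0, Fintype.sum_option]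
  congr 1
  · unfold labelCount preservedCount
    rw [Finset.mul_sum]
    refine Finset.sum_congr rfl fun τ _ => ?_
    rw [Fintype.sum_prod_type]
    simp only [connects_insertPair_none]
    have : ∀ (x : Fin N) (a : X → Fin N), (Matching.insertPair none τ).Preserves
        ((fun o : Option X => o.elim x a) ∘ Prod.fst ∘ optionProdBoolEquiv X) ↔
        τ.Preserves (a ∘ Prod.fst) := fun x a => by
      rw [Matching.insertPair_none_preserves _ _ rfl]; rfl
    simp only [this]
    rw [Finset.sum_const, Finset.card_univ, Fintype.card_fin, nsmul_eq_mul]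
    rfl
  · refine Finset.sum_congr rfl fun r _ => ?_
    have : ∀ (τ : Matching (X × Bool)) (x : Fin N) (a : X → Fin N),
        (Matching.insertPair (some r) τ).Preserves
        ((fun o : Option X => o.elim x a) ∘ Prod.fst ∘ optionProdBoolEquiv X) ↔
        x = a r.1 ∧ τ.Preserves (a ∘ Prod.fst) := fun τ x a => by
      rw [Matching.insertPair_some_preserves _ _ _ rfl]; rfl
    simp only [Fintype.sum_prod_type_right, this]
    split_ifs with h
    · simp only [connects_insertPair_some_of_eq β r _ h, and_left_comm (b := _ = _), ite_and,
        Finset.sum_ite_eq', Finset.mem_univ, if_true]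
      unfold labelCount preservedCount
      simp only [ite_and, Function.comp_assoc]
    · simp only [connects_insertPair_some_of_ne β r _ h, and_left_comm (b := _ = _), ite_and,
        Finset.sum_ite_eq', Finset.mem_univ, if_true]
      unfold labelCount preservedCount
      simp only [ite_and]

open Classical in
/-- The number of points in a block. -/
def blockSize [Fintype X] (β : X → ι) (i : ι) : ℝ := Fintype.card {x // β x = i}

/-- The leading coefficient of `labelCount β` as a polynomial. -/
def blockCoeff [Fintype X] [Fintype ι] (β : X → ι) : ℝ :=
  -- For one block the general formula would call for the falling factorial of index -1, that is
  -- 1/|X|, which cancels the block size |X|. Truncated subtraction would give index 0, so this case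
  -- is set apart.
  if Fintype.card ι = 1 then 1 else
    2 ^ (Fintype.card ι - 1) * (∏ i, blockSize β i) *
      ((Fintype.card X - 1).descFactorial (Fintype.card ι - 2) : ℝ)

theorem blockSize_congr [Fintype X] [Fintype X'] (e : X ≃ X') (β : X' → ι) :
    blockSize (β ∘ e) = blockSize β := by
  classical
  ext i
  unfold blockSize
  rw [Fintype.card_congr (e.subtypeEquiv (p := fun x => (β ∘ e) x = i) (q := fun x => β x = i)
    fun x => Iff.rfl)]

theorem blockCoeff_congr [Fintype X] [Fintype X'] [Fintype ι] (e : X ≃ X') (β : X' → ι) :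
    blockCoeff (β ∘ e) = blockCoeff β := by
  unfold blockCoeff
  rw [blockSize_congr, Fintype.card_congr e]

open Classical in
theorem blockSize_eq_sum [Fintype X] (β : X → ι) (i : ι) :
    blockSize β i = ∑ x, if β x = i then (1 : ℝ) else 0 := by
  rw [blockSize, Fintype.card_subtype, Finset.sum_boole]

open Classical in
theorem blockSize_option [Fintype X] (β : Option X → ι) (i : ι) :
    blockSize β i = (if β none = i then 1 else 0) + blockSize (β ∘ some) i := by
  simp only [blockSize_eq_sum, Fintype.sum_option, Function.comp_apply]

open Classical in
theorem blockSize_mergeBlocks [Fintype X] (β : X → ι) (i₀ : ι) (j i : {i // i ≠ i₀}) :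
    blockSize (mergeBlocks β i₀ j) i =
      blockSize β i + if i = j then blockSize β i₀ else 0 := by
  simp only [blockSize_eq_sum]
  by_cases hij : i = j
  · subst hij
    rw [if_pos rfl, ← Finset.sum_add_distrib]
    refine Finset.sum_congr rfl fun x _ => ?_
    by_cases h : β x = i₀
    · simp [mergeBlocks, h, i.2.symm]
    · simp [mergeBlocks, h, Subtype.ext_iff]
  · rw [if_neg hij, add_zero]
    refine Finset.sum_congr rfl fun x _ => ?_
    by_cases h : β x = i₀
    · simp [mergeBlocks, h, i.2.symm, Ne.symm hij]
    · simp [mergeBlocks, h, Subtype.ext_iff]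

open Classical in
theorem sum_comp_eq_sum_blockSize_mul [Fintype X] [Fintype ι] (β : X → ι) (F : ι → ℝ) :
    ∑ x, F (β x) = ∑ i, blockSize β i * F i := by
  simp only [blockSize_eq_sum, Finset.sum_mul, ite_mul, one_mul, zero_mul]
  rw [Finset.sum_comm]
  simp

theorem sum_blockSize [Fintype X] [Fintype ι] (β : X → ι) :
    ∑ i, blockSize β i = Fintype.card X := by
  have := sum_comp_eq_sum_blockSize_mul β fun _ => 1
  simpa using this.symm

theorem prod_eq_mul_prod_ne [Fintype ι] [DecidableEq ι] (f : ι → ℝ) (i₀ : ι) :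
    ∏ i, f i = f i₀ * ∏ i : {i // i ≠ i₀}, f i := by
  rw [Fintype.prod_eq_mul_prod_compl i₀]
  congr 1
  rw [Finset.prod_subtype]
  simp

theorem sum_eq_add_sum_ne [Fintype ι] [DecidableEq ι] (f : ι → ℝ) (i₀ : ι) :
    ∑ i, f i = f i₀ + ∑ i : {i // i ≠ i₀}, f i := by
  rw [Fintype.sum_eq_add_sum_compl i₀]
  congr 1
  rw [Finset.sum_subtype]
  simp

/-- Applied to block sizes: merging a block of size `c` into `j`, weighted by the size of `j`, gives
an expression affine in `f j`, which can be summed over `j`. -/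
theorem mul_prod_add_ite [Fintype ι] [DecidableEq ι] (f : ι → ℝ) (j : ι) (c : ℝ) :
    f j * ∏ i, (f i + if i = j then c else 0) = (f j + c) * ∏ i, f i := by
  rw [Fintype.prod_eq_mul_prod_compl j, Fintype.prod_eq_mul_prod_compl j f, if_pos rfl]
  have : ∏ i ∈ ({j} : Finset ι)ᶜ, (f i + if i = j then c else 0) = ∏ i ∈ ({j} : Finset ι)ᶜ, f i :=
    Finset.prod_congr rfl fun i hi => by
      rw [if_neg (by simpa using hi), add_zero]
  rw [this]
  ring

end

/-! ### The leading term of the label count. -/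

section

variable {X X' ι : Type}

theorem sum_prod_bool [Fintype X] (f : X → ℝ) : ∑ r : X × Bool, f r.1 = 2 * ∑ x, f x := by
  simp [Fintype.sum_prod_type, Finset.mul_sum]

open Classical in
theorem sum_prod_bool_dite [Fintype X] [Fintype ι] (β : X → ι) (i₀ : ι) (F : {i // i ≠ i₀} → ℝ) :
    (∑ r : X × Bool, if h : β r.1 = i₀ then 0 else F ⟨β r.1, h⟩) =
      2 * ∑ i : {i // i ≠ i₀}, blockSize β i * F i := by
  have h1 := sum_comp_eq_sum_blockSize_mul β fun i => if h : i = i₀ then 0 else F ⟨i, h⟩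
  rw [sum_eq_add_sum_ne _ i₀] at h1
  refine (sum_prod_bool fun x => if h : β x = i₀ then 0 else F ⟨β x, h⟩).trans ?_
  rw [h1]
  congr 1
  rw [dif_pos rfl, mul_zero, zero_add]
  refine Finset.sum_congr rfl fun i _ => ?_
  rw [dif_neg i.2]

open Classical in
-- This is the leading part of the recursion `labelCount_option`; insertions into the block of
-- `none` itself contribute 0, as they lose a power of `N`. With t + 3 blocks, block sizes m₀, m_j
-- outside and inside the surviving blocks, and |X| = n + 1, it reduces to (1 + m₀)(n + 1) = m₀(n -
-- t) + (n + 1 - m₀) + (t + 2)m₀.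
theorem blockCoeff_option [Fintype X] [Fintype ι] (β : Option X → ι) :
    blockCoeff β = blockCoeff (β ∘ some) + ∑ r : X × Bool,
      if h : β (some r.1) = β none then 0
      else blockCoeff (mergeBlocks (β ∘ some) (β none) ⟨β (some r.1), h⟩) := by
  have hm : ∀ i : {i // i ≠ β none}, blockSize β i = blockSize (β ∘ some) i := fun i => by
    rw [blockSize_option, if_neg (Ne.symm i.2), zero_add]
  have hm0 : blockSize β (β none) = 1 + blockSize (β ∘ some) (β none) := by
    rw [blockSize_option, if_pos rfl]
  have hsum := sum_prod_bool_dite (β ∘ some) (β none) fun j =>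
    blockCoeff (mergeBlocks (β ∘ some) (β none) j)
  simp only [Function.comp_apply] at hsum
  rw [hsum]
  have hcard : Fintype.card {i // i ≠ β none} = Fintype.card ι - 1 := by simp
  have hpos : 0 < Fintype.card ι := Fintype.card_pos_iff.2 ⟨β none⟩
  have hn := sum_blockSize (β ∘ some)
  rw [sum_eq_add_sum_ne _ (β none)] at hn
  generalize hk : Fintype.card ι = k at *
  match k, hpos with
  | 1, _ =>
    have : IsEmpty {i // i ≠ β none} := Fintype.card_eq_zero_iff.1 hcard
    simp [blockCoeff, hk]
  | 2, _ =>
    obtain ⟨j, hj⟩ := Fintype.card_eq_one_iff.1 hcard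
    have : Unique {i // i ≠ β none} := ⟨⟨j⟩, hj⟩
    simp only [blockCoeff, hk, hcard]
    rw [prod_eq_mul_prod_ne _ (β none), prod_eq_mul_prod_ne (blockSize (β ∘ some)) (β none)]
    simp only [hm, hm0, Fintype.prod_unique, Fintype.sum_unique]
    norm_num
    ring
  | t + 3, _ =>
    simp only [blockCoeff, hk, hcard]
    rw [prod_eq_mul_prod_ne _ (β none), prod_eq_mul_prod_ne (blockSize (β ∘ some)) (β none)]
    simp only [hm, hm0]
    simp only [blockSize_mergeBlocks]
    set m := blockSize (β ∘ some)
    set m0 := m (β none)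
    have e1 : t + 3 - 1 = t + 2 := rfl
    have e2 : t + 3 - 2 = t + 1 := rfl
    have e3 : t + 2 - 1 = t + 1 := rfl
    have e4 : t + 2 - 2 = t := rfl
    simp only [e1, e2, e3, e4, Fintype.card_option, Nat.add_sub_cancel]
    rw [if_neg (by omega), if_neg (by omega)]
    simp only [show ¬ t + 2 = 1 by omega, if_false]
    set M := ∏ i : {i // i ≠ β none}, m i with hM
    have hmul : ∀ j : {i // i ≠ β none}, m j * (2 ^ (t + 1) *
        (∏ i : {i // i ≠ β none}, (m i + if i = j then m0 else 0)) *
        ((Fintype.card X - 1).descFactorial t : ℝ)) =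
        (m j + m0) * (2 ^ (t + 1) * M * ((Fintype.card X - 1).descFactorial t : ℝ)) := by
      intro j
      have := mul_prod_add_ite (fun i : {i // i ≠ β none} => m i) j m0
      linear_combination (2 ^ (t + 1) * ((Fintype.card X - 1).descFactorial t : ℝ)) * this
    simp only [hmul]
    rw [← Finset.sum_mul, Finset.sum_add_distrib, Finset.sum_const, Finset.card_univ, hcard,
      nsmul_eq_mul]
    have hs : ∑ i : {i // i ≠ β none}, m i = Fintype.card X - m0 := by linarith
    rw [hs]
    -- For empty `X` the truncated |X| - 1 is wrong, but the product of the block sizes vanishes.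
    rcases Nat.eq_zero_or_pos (Fintype.card X) with h0 | h0
    · have hX : IsEmpty X := Fintype.card_eq_zero_iff.1 h0
      have hM0 : M = 0 := by
        have : Nonempty {i // i ≠ β none} := Fintype.card_pos_iff.1 (by omega)
        obtain ⟨j⟩ := this
        refine Finset.prod_eq_zero (Finset.mem_univ j) ?_
        simp [m, blockSize_eq_sum]
      rw [hM0]; ring
    · obtain ⟨n, hn'⟩ : ∃ n, Fintype.card X = n + 1 := ⟨_, (Nat.succ_pred_eq_of_pos h0).symm⟩
      rw [hn', Nat.add_sub_cancel, Nat.succ_descFactorial_succ, Nat.descFactorial_succ]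
      -- Truncation is harmless: for t > n the falling factorial is zero.
      have hd : (((n - t : ℕ) * n.descFactorial t : ℕ) : ℝ) = ((n : ℝ) - t) * n.descFactorial t := by
        rcases le_or_gt t n with h | h
        · push_cast [Nat.cast_sub h]; ring
        · simp [Nat.descFactorial_of_lt h]
      rw [hd]
      push_cast
      ring

theorem isBigO_natCast_pow_of_le {i j : ℕ} (h : i ≤ j) :
    (fun N : ℕ => (N : ℝ) ^ i) =O[atTop] fun N : ℕ => (N : ℝ) ^ j := by
  refine IsBigO.of_bound 1 ?_
  filter_upwards [eventually_ge_atTop 1] with N hN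
  have hN' : (1 : ℝ) ≤ N := by exact_mod_cast hN
  rw [one_mul, Real.norm_of_nonneg (by positivity), Real.norm_of_nonneg (by positivity)]
  exact pow_le_pow_right₀ hN' h

theorem natCast_mul_isBigO {f : ℕ → ℝ} {i : ℕ} (h : f =O[atTop] fun N : ℕ => (N : ℝ) ^ i) :
    (fun N : ℕ => (N : ℝ) * f N) =O[atTop] fun N : ℕ => (N : ℝ) ^ (i + 1) := by
  simp only [pow_succ']
  exact (isBigO_refl _ _).mul h

/-- Up to lower order terms, `labelCount β` is a monomial whose degree is the number of points minus
the number of blocks plus one. -/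
theorem labelCount_isBigO [Fintype X] [Fintype ι] [Nonempty ι] (β : X → ι) :
    (fun N : ℕ => (N : ℝ) ^ Fintype.card ι * labelCount β N -
      blockCoeff β * (N : ℝ) ^ (Fintype.card X + 1)) =O[atTop]
      fun N : ℕ => (N : ℝ) ^ Fintype.card X := by
  classical
  generalize hn : Fintype.card X = n
  induction n generalizing X ι with
  -- Without points there is one matching and one labelling, and the blocks are connected exactly
  -- when there is only one of them. The difference is then identically zero.
  | zero =>
    have hX : IsEmpty X := Fintype.card_eq_zero_iff.1 hn
    have hu : Unique (Matching (X × Bool)) :=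
      { default := ⟨isEmptyElim, fun y => isEmptyElim y, fun y => isEmptyElim y⟩
        uniq := fun τ => Subtype.ext (funext fun y => isEmptyElim y) }
    have hp : ∀ (τ : Matching (X × Bool)) (Z : Type) (h : X × Bool → Z), τ.Preserves h :=
      fun τ Z h y => isEmptyElim y
    refine (isBigO_zero _ _).congr_left fun N => ?_
    symm
    by_cases h1 : Fintype.card ι = 1
    · have hs : Subsingleton ι := Fintype.card_le_one_iff_subsingleton.1 h1.le
      have hc : ∀ τ : Matching (X × Bool), τ.Connects (β ∘ Prod.fst) := fun τ f _ i j => by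
        rw [Subsingleton.elim i j]
      simp [labelCount, preservedCount, blockCoeff, h1, hp, hc]
    · have hlt : 1 < Fintype.card ι := by have := Fintype.card_pos (α := ι); omega
      obtain ⟨i, j, hij⟩ := Fintype.one_lt_card_iff.1 hlt
      have hc : ∀ τ : Matching (X × Bool), ¬ τ.Connects (β ∘ Prod.fst) := fun τ h => by
        have := h (fun l => decide (l = i)) (hp _ _ _) i j
        simp at this
        exact hij this.symm
      have hz : ∏ i, blockSize β i = 0 :=
        Finset.prod_eq_zero (Finset.mem_univ i) (by simp [blockSize_eq_sum])
      simp [labelCount, preservedCount, blockCoeff, h1, hc, hz]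
  | succ n ih =>
    let e : Option (Fin n) ≃ X := Fintype.equivOfCardEq (by simp [hn])
    rw [← blockCoeff_congr e]
    simp only [← labelCount_congr e β]
    generalize β ∘ e = γ
    simp only [labelCount_option, blockCoeff_option]
    have h1 := ih (γ ∘ some) (Fintype.card_fin n)
    have hb : (fun N : ℕ => (N : ℝ) ^ Fintype.card ι * labelCount (γ ∘ some) N) =O[atTop]
        fun N : ℕ => (N : ℝ) ^ (n + 1) := by
      have := (h1.trans (isBigO_natCast_pow_of_le (Nat.le_succ n))).add
        ((isBigO_refl (fun N : ℕ => (N : ℝ) ^ (n + 1)) atTop).const_mul_left (blockCoeff (γ ∘ some)))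
      exact this.congr_left fun N => by ring
    -- An insertion into the same block removes a point but no block, so its term is of lower order.
    -- An insertion into another block removes one of each and keeps the degree.
    have h2 : ∀ r : Fin n × Bool, (fun N : ℕ => (N : ℝ) ^ Fintype.card ι *
        (if h : γ (some r.1) = γ none then labelCount (γ ∘ some) N
          else labelCount (mergeBlocks (γ ∘ some) (γ none) ⟨γ (some r.1), h⟩) N) -
        (if h : γ (some r.1) = γ none then 0
          else blockCoeff (mergeBlocks (γ ∘ some) (γ none) ⟨γ (some r.1), h⟩)) *
        (N : ℝ) ^ (n + 1 + 1)) =O[atTop] fun N : ℕ => (N : ℝ) ^ (n + 1) := by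
      intro r
      by_cases h : γ (some r.1) = γ none
      · simp only [h, dif_pos, zero_mul, sub_zero]
        exact hb
      · simp only [h, dif_neg, not_false_eq_true]
        have : Nonempty {i // i ≠ γ none} := ⟨⟨_, h⟩⟩
        have h3 := natCast_mul_isBigO
          (ih (mergeBlocks (γ ∘ some) (γ none) ⟨γ (some r.1), h⟩) (Fintype.card_fin n))
        refine h3.congr_left fun N => ?_
        have hc : Fintype.card ι = Fintype.card {i // i ≠ γ none} + 1 := by
          have : 0 < Fintype.card ι := Fintype.card_pos
          simp; omega
        rw [hc]; ring
    have h3 := (natCast_mul_isBigO h1).add (IsBigO.sum fun r (_ : r ∈ Finset.univ) => h2 r)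
    refine h3.congr_left fun N => ?_
    rw [Finset.sum_apply, Finset.sum_sub_distrib, ← Finset.mul_sum, ← Finset.sum_mul]
    ring

end

/-! ### Chains of label sets: extremal bound and parity. -/

section

variable {X V ι : Type}

/-- The index sets which are exhausted by adding one set of the family at a time, each one meeting
a previous one. -/
inductive Chained [DecidableEq X] [DecidableEq ι] (A : ι → Finset X) : Finset ι → Prop
  | single (i : ι) : Chained A {i}
  | insert {s : Finset ι} {i : ι} (hs : Chained A s) (hi : i ∉ s)
      (h : ∃ j ∈ s, (A i ∩ A j).Nonempty) : Chained A (insert i s)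

theorem Chained.nonempty [DecidableEq X] [DecidableEq ι] {A : ι → Finset X} {s : Finset ι}
    (hs : Chained A s) : s.Nonempty := by
  cases hs <;> simp

/-- A maximal chained index set is closed under passing to a set that meets one of its members, so
its indicator is constant by the connectedness hypothesis. -/
theorem chained_univ [DecidableEq X] [DecidableEq ι] [Fintype ι] [Nonempty ι] {A : ι → Finset X}
    (hA : ∀ f : ι → Bool, (∀ i j, (A i ∩ A j).Nonempty → f i = f j) → ∀ i j, f i = f j) :
    Chained A Finset.univ := by
  obtain ⟨i₀⟩ := ‹Nonempty ι›
  obtain ⟨s, hs, hmax⟩ := (Set.toFinite {s | Chained A s}).exists_maximal ⟨{i₀}, Chained.single i₀⟩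
  have key : ∀ i j, (A i ∩ A j).Nonempty → i ∈ s → j ∈ s := by
    intro i j hij hi
    by_contra hj
    have h1 : Chained A (insert j s) := Chained.insert hs hj ⟨i, hi, by rwa [Finset.inter_comm]⟩
    exact hj (hmax h1 (Finset.subset_insert j s) (Finset.mem_insert_self j s))
  obtain ⟨i₁, hi₁⟩ := Chained.nonempty hs
  have := hA (fun i => decide (i ∈ s)) (fun i j hij => by
    have h1 := key i j hij
    have h2 := key j i (by rwa [Finset.inter_comm])
    simp only [decide_eq_decide]
    exact ⟨h1, h2⟩) i₁
  have hs' : s = Finset.univ := by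
    ext j
    simpa [hi₁] using this j
  exact hs' ▸ hs

/-- Every set after the first shares a point with its predecessors and so contributes at most p - 1
new points. -/
theorem Chained.card_biUnion_add_card_le [DecidableEq X] [DecidableEq ι] {A : ι → Finset X}
    {s : Finset ι} {p : ℕ} (hs : Chained A s) (hA : ∀ i, (A i).card ≤ p) :
    (s.biUnion A).card + s.card ≤ 1 + s.card * p := by
  induction hs with
  | single i => simp; have := hA i; omega
  | @insert s i hs hi h ih =>
    rw [Finset.biUnion_insert, Finset.card_insert_of_notMem hi]
    have h1 := Finset.card_union_add_card_inter (A i) (s.biUnion A)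
    have h2 : 0 < (A i ∩ s.biUnion A).card := by
      obtain ⟨j, hj, x, hx⟩ := h
      refine Finset.card_pos.2 ⟨x, ?_⟩
      simp only [Finset.mem_inter, Finset.mem_biUnion] at hx ⊢
      exact ⟨hx.1, j, hj, hx.2⟩
    have h3 := hA i
    rw [Nat.add_mul]
    omega

/-- Equality passes to every stage of the chain: each added set has p elements and a single old one.
As p ≥ 2, the last set has a point of its own, which distinguishes it from the others and fixes the
parity of its weight; peeling it off leaves the same situation. -/
theorem Chained.of_card_eq [DecidableEq X] [DecidableEq ι] {A : ι → Finset X}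
    {s : Finset ι} {p : ℕ} (hp : 2 ≤ p) (hs : Chained A s) (hA : ∀ i, (A i).card ≤ p)
    (heq : (s.biUnion A).card + s.card = 1 + s.card * p) :
    (∀ i ∈ s, (A i).card = p) ∧ Set.InjOn A s ∧
      ∀ m : ι → ℕ, (∀ x, Even (∑ i ∈ s, if x ∈ A i then m i else 0)) → ∀ i ∈ s, Even (m i) := by
  induction hs with
  | single i =>
    simp only [Finset.singleton_biUnion, Finset.card_singleton] at heq
    have hi : (A i).card = p := by omega
    refine ⟨by simpa using hi, by simp, fun m hm => ?_⟩
    obtain ⟨x, hx⟩ := Finset.card_pos.1 (by omega : 0 < (A i).card)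
    simpa [hx] using hm x
  | @insert s i hs hi h ih =>
    rw [Finset.biUnion_insert, Finset.card_insert_of_notMem hi] at heq
    have h1 := Finset.card_union_add_card_inter (A i) (s.biUnion A)
    have h2 : 0 < (A i ∩ s.biUnion A).card := by
      obtain ⟨j, hj, x, hx⟩ := h
      refine Finset.card_pos.2 ⟨x, ?_⟩
      simp only [Finset.mem_inter, Finset.mem_biUnion] at hx ⊢
      exact ⟨hx.1, j, hj, hx.2⟩
    have h3 := hA i
    have h4 := hs.card_biUnion_add_card_le hA
    rw [Nat.add_mul] at heq
    obtain ⟨g1, g2, g3⟩ := ih (by omega)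
    have h5 : (A i ∩ s.biUnion A).card < (A i).card := by omega
    obtain ⟨y, hy, hy'⟩ : ∃ y ∈ A i, y ∉ s.biUnion A := by
      by_contra! hc
      rw [Finset.inter_eq_left.2 hc] at h5
      exact lt_irrefl _ h5
    have hy'' : ∀ j ∈ s, y ∉ A j := fun j hj hyj => hy' (Finset.mem_biUnion.2 ⟨j, hj, hyj⟩)
    refine ⟨?_, ?_, fun m hm => ?_⟩
    · intro j hj
      rcases Finset.mem_insert.1 hj with rfl | hj
      · omega
      · exact g1 j hj
    · rw [Finset.coe_insert, Set.injOn_insert (by simpa using hi)]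
      refine ⟨g2, ?_⟩
      rintro ⟨j, hj, hji⟩
      exact hy'' j hj (hji ▸ hy)
    -- Only the set of index `i` contains `y`, so the sum at `y` is `m i`.
    · have h6 : Even (m i) := by
        have := hm y
        rw [Finset.sum_insert hi, if_pos hy, Finset.sum_eq_zero] at this
        · simpa using this
        · exact fun j hj => if_neg (hy'' j hj)
      have h7 := g3 m fun x => by
        have := hm x
        rw [Finset.sum_insert hi] at this
        split_ifs at this
        · exact (Nat.even_add.1 this).1 h6
        · simpa using this
      intro j hj
      rcases Finset.mem_insert.1 hj with rfl | hj
      · exact h6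
      · exact h7 j hj

/-- The matching restricts to an involution of `s` without fixed points, so the sum of ones over `s`
vanishes modulo 2. -/
theorem Matching.even_card_of_forall_mem {Y : Type} (τ : Matching Y) (s : Finset Y)
    (hs : ∀ y ∈ s, τ.1 y ∈ s) : Even s.card := by
  have h := Finset.sum_involution (s := s) (f := fun _ => (1 : ZMod 2)) (fun y _ => τ.1 y)
    (fun y _ => by decide) (fun y _ _ => τ.2.2 y) (fun y hy => hs y hy) (fun y _ => τ.2.1 y)
  rw [Finset.sum_const, nsmul_eq_mul, mul_one] at h
  exact (ZMod.natCast_eq_zero_iff_even).1 h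

open Classical in
/-- The number of labels used by a labelling. -/
def imageCard {Q : Type} [Fintype Q] (a : Q → X) : ℕ := (Finset.univ.image a).card

open Classical in
/-- The set of labels of a row. -/
def rowImage {p : ℕ} (a : V × Fin p → X) (v : V) : Finset X := Finset.univ.image fun j => a (v, j)

theorem card_rowImage_le {p : ℕ} (a : V × Fin p → X) (v : V) : (rowImage a v).card ≤ p := by
  classical
  exact Finset.card_image_le.trans (by simp)

/-- Data of a labelling of rows of length `p` preserved by a matching, where the rows are grouped
into classes with equal sets of labels that are connected by the matching. -/
structure RowClasses [Fintype V] {p : ℕ} (τ : Matching (V × Fin p)) (a : V × Fin p → X)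
    (c : V → ι) : Prop where
  preserves : τ.Preserves a
  connects : τ.Connects (c ∘ Prod.fst)
  surjective : Function.Surjective c
  rowImage_eq : ∀ v v', c v = c v' → rowImage a v = rowImage a v'

namespace RowClasses

variable [Fintype V] {p : ℕ} {τ : Matching (V × Fin p)}
  {a : V × Fin p → X} {c : V → ι}

/-- The common set of labels of the rows of a class. -/
def labels (h : RowClasses τ a c) (i : ι) : Finset X := rowImage a (Function.surjInv h.surjective i)

theorem labels_apply (h : RowClasses τ a c) (v : V) : h.labels (c v) = rowImage a v :=
  h.rowImage_eq _ _ (Function.surjInv_eq h.surjective _)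

open Classical in
-- Matched halfedges carry the same label, so the label sets of their rows meet.
theorem chained [Fintype ι] [Nonempty ι] (h : RowClasses τ a c) : Chained h.labels Finset.univ := by
  refine chained_univ fun f hf => h.connects f fun q => ?_
  refine hf _ _ ⟨a q, ?_⟩
  rw [Function.comp_apply, Function.comp_apply, labels_apply, labels_apply, Finset.mem_inter]
  refine ⟨?_, ?_⟩
  · rw [← h.preserves q]
    exact Finset.mem_image_of_mem (fun j => a ((τ.1 q).1, j)) (Finset.mem_univ (τ.1 q).2)
  · exact Finset.mem_image_of_mem (fun j => a (q.1, j)) (Finset.mem_univ q.2)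

open Classical in
theorem biUnion_labels [Fintype ι] (h : RowClasses τ a c) :
    Finset.univ.biUnion h.labels = Finset.univ.image a := by
  ext x
  simp only [Finset.mem_biUnion, Finset.mem_univ, true_and, Finset.mem_image, Prod.exists]
  constructor
  · rintro ⟨i, hi⟩
    obtain ⟨v, rfl⟩ := h.surjective i
    rw [labels_apply] at hi
    obtain ⟨j, -, hj⟩ := Finset.mem_image.1 hi
    exact ⟨v, j, hj⟩
  · rintro ⟨v, j, rfl⟩
    refine ⟨c v, ?_⟩
    rw [labels_apply]
    exact Finset.mem_image_of_mem (fun j => a (v, j)) (Finset.mem_univ j)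

theorem imageCard_add_card_le [Fintype ι] [Nonempty ι] (h : RowClasses τ a c) :
    imageCard a + Fintype.card ι ≤ 1 + Fintype.card ι * p := by
  classical
  have := h.chained.card_biUnion_add_card_le (p := p) fun i => card_rowImage_le _ _
  rwa [biUnion_labels, Finset.card_univ] at this

open Classical in
-- For the parity claim, the weight of a class is its number of rows in `S`. The halfedges of `S`
-- with a given label are stable under `τ`, hence even in number, which is the hypothesis of
-- `Chained.of_card_eq`.
theorem of_card_eq [Fintype ι] [Nonempty ι] (hp : 2 ≤ p) (h : RowClasses τ a c)
    (heq : imageCard a + Fintype.card ι = 1 + Fintype.card ι * p) :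
    (∀ v, Function.Injective fun j => a (v, j)) ∧
      (∀ v v', rowImage a v = rowImage a v' → c v = c v') ∧
      ∀ S : Finset V, (∀ q, q.1 ∈ S → (τ.1 q).1 ∈ S) → ∀ i, Even (S.filter fun v => c v = i).card := by
  obtain ⟨h1, h2, h3⟩ := h.chained.of_card_eq hp (fun i => card_rowImage_le _ _)
    (by rwa [biUnion_labels, Finset.card_univ])
  have hinj : ∀ v, Function.Injective fun j => a (v, j) := by
    intro v
    have := h1 (c v) (Finset.mem_univ _)
    rw [labels_apply, rowImage] at this
    have := Finset.card_image_iff.1 (this.trans (by simp : p = (Finset.univ : Finset (Fin p)).card))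
    exact fun i j hij => this (by simp) (by simp) hij
  refine ⟨hinj, ?_, ?_⟩
  · intro v v' hv
    refine h2 (Finset.mem_coe.2 (Finset.mem_univ _)) (Finset.mem_coe.2 (Finset.mem_univ _)) ?_
    rw [labels_apply, labels_apply, hv]
  · intro S hS i
    refine h3 (fun i => (S.filter fun v => c v = i).card) (fun x => ?_) i (Finset.mem_univ i)
    -- Rows have distinct labels, so each row of `S` whose label set contains `x` has exactly one
    -- halfedge labelled `x`.
    have e1 : (∑ i, if x ∈ h.labels i then (S.filter fun v => c v = i).card else 0) =
        (Finset.univ.filter fun q : V × Fin p => q.1 ∈ S ∧ a q = x).card := by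
      have e2 : ∀ v, (∑ j, if a (v, j) = x then 1 else 0) = if x ∈ rowImage a v then 1 else 0 := by
        intro v
        split_ifs with hx
        · obtain ⟨j, -, hj⟩ := Finset.mem_image.1 hx
          rw [Finset.sum_eq_single j]
          · simp [hj]
          · intro b _ hb
            exact if_neg fun hb' => hb (hinj v (hb'.trans hj.symm))
          · simp
        · refine Finset.sum_eq_zero fun j _ => if_neg fun hj => hx ?_
          exact Finset.mem_image.2 ⟨j, Finset.mem_univ j, hj⟩
      rw [Finset.card_filter, Fintype.sum_prod_type]
      have e4 : ∀ v, (∑ j, if v ∈ S ∧ a (v, j) = x then 1 else 0) =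
          if v ∈ S then (if x ∈ h.labels (c v) then 1 else 0) else 0 := by
        intro v
        by_cases hv : v ∈ S
        · simp only [hv, true_and, if_true, e2, labels_apply]
        · simp [hv]
      simp only [e4, Finset.card_filter]
      rw [← Finset.sum_filter (fun v => v ∈ S)]
      simp only [Finset.filter_mem_eq_inter, Finset.univ_inter]
      have e3 : ∀ i, (if x ∈ h.labels i then ∑ v ∈ S, (if c v = i then 1 else 0) else 0) =
          ∑ v ∈ S, if c v = i then (if x ∈ h.labels (c v) then 1 else 0) else 0 := by
        intro i
        split_ifs with hx
        · refine Finset.sum_congr rfl fun v _ => ?_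
          split_ifs with h4 h5
          · rfl
          · exact absurd (h4 ▸ hx) h5
          · rfl
        · symm
          refine Finset.sum_eq_zero fun v _ => ?_
          split_ifs with h4 h5
          · exact absurd (h4 ▸ h5) hx
          · rfl
          · rfl
      simp only [e3]
      rw [Finset.sum_comm]
      simp
    rw [e1]
    refine τ.even_card_of_forall_mem _ fun q hq => ?_
    simp only [Finset.mem_filter, Finset.mem_univ, true_and] at hq ⊢
    exact ⟨hS q hq.1, (h.preserves q).trans hq.2⟩

end RowClasses

end

/-! ### Rows agreeing up to permutation, and their pairings. -/

section

variable {X V Q ι : Type}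

open Classical in
-- A labelling with at most `R` labels factors through `Fin R`.
theorem card_imageCard_le [Fintype Q] (R : ℕ) {N : ℕ} (hN : 1 ≤ N) :
    (Finset.univ.filter fun a : Q → Fin N => imageCard a ≤ R).card ≤
      R ^ Fintype.card Q * N ^ R := by
  have h1 : (Finset.univ.filter fun a : Q → Fin N => imageCard a ≤ R) ⊆
      Finset.univ.image fun q : (Q → Fin R) × (Fin R → Fin N) => q.2 ∘ q.1 := by
    intro a ha
    simp only [Finset.mem_filter, Finset.mem_univ, true_and] at ha
    have : Nonempty (Fin N) := ⟨⟨0, hN⟩⟩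
    obtain ⟨f⟩ : Nonempty (↥(Finset.univ.image a) ↪ Fin R) :=
      Function.Embedding.nonempty_of_card_le (by
        rw [Fintype.card_coe, Fintype.card_fin]; convert ha; unfold imageCard; congr!)
    refine Finset.mem_image.2 ⟨(fun q => f ⟨a q, Finset.mem_image_of_mem a (Finset.mem_univ q)⟩,
      fun r => if h : ∃ y, f y = r then (h.choose : Fin N) else Classical.arbitrary _),
      Finset.mem_univ _, ?_⟩
    ext1 q
    have h : ∃ y, f y = f ⟨a q, Finset.mem_image_of_mem a (Finset.mem_univ q)⟩ := ⟨_, rfl⟩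
    simp only [Function.comp_apply, dif_pos h]
    rw [f.injective h.choose_spec]
  refine (Finset.card_le_card h1).trans (Finset.card_image_le.trans ?_)
  simp

theorem abs_sum_le_of_imageCard_le [Fintype Q] {R N : ℕ} [Fintype (Q → Fin N)] (hN : 1 ≤ N) {C : ℝ}
    (f : (Q → Fin N) → ℝ) (hC : ∀ a, |f a| ≤ C) (hf : ∀ a, R < imageCard a → f a = 0) :
    |∑ a, f a| ≤ C * (R : ℝ) ^ Fintype.card Q * (N : ℝ) ^ R := by
  classical
  have hC0 : 0 ≤ C := (abs_nonneg _).trans (hC fun _ => ⟨0, hN⟩)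
  have h1 : ∑ a, f a = ∑ a ∈ Finset.univ.filter fun a : Q → Fin N => imageCard a ≤ R, f a := by
    rw [Finset.sum_filter]
    refine Finset.sum_congr rfl fun a _ => ?_
    split_ifs with h
    · rfl
    · exact hf a (not_le.1 h)
  rw [h1]
  refine (Finset.abs_sum_le_sum_abs _ _).trans
    ((Finset.sum_le_card_nsmul _ _ C fun a _ => hC a).trans ?_)
  rw [nsmul_eq_mul, mul_comm, mul_assoc]
  refine mul_le_mul_of_nonneg_left ?_ hC0
  have h2 := card_imageCard_le (Q := Q) R hN
  refine le_trans (Nat.cast_le.2 (le_of_eq ?_)) (by exact_mod_cast h2)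
  congr!

/-- Two rows agree up to a permutation of their entries. -/
def RowEquiv {p : ℕ} (a : V × Fin p → X) (v v' : V) : Prop :=
  ∃ s : Equiv.Perm (Fin p), ∀ j, a (v', j) = a (v, s j)

/-- Rows up to permutations of their entries. -/
def rowSetoid {p : ℕ} (a : V × Fin p → X) : Setoid V where
  r := RowEquiv a
  iseqv :=
    { refl := fun v => ⟨1, fun j => rfl⟩
      symm := fun {v v'} ⟨s, h⟩ => ⟨s⁻¹, fun j => by rw [h]; simp⟩
      trans := fun {u v w} ⟨s, h⟩ ⟨t, h'⟩ => ⟨s * t, fun j => by rw [h', h]; rfl⟩ }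

theorem RowEquiv.symm {p : ℕ} {a : V × Fin p → X} {v v' : V} (h : RowEquiv a v v') :
    RowEquiv a v' v := (rowSetoid a).symm h

theorem RowEquiv.rowImage_eq {p : ℕ} {a : V × Fin p → X} {v v' : V} (h : RowEquiv a v v') :
    rowImage a v = rowImage a v' := by
  classical
  obtain ⟨s, hs⟩ := h
  ext x
  simp only [rowImage, Finset.mem_image, Finset.mem_univ, true_and, hs]
  exact ⟨fun ⟨j, hj⟩ => ⟨s.symm j, by simpa using hj⟩, fun ⟨j, hj⟩ => ⟨s j, hj⟩⟩

theorem rowClasses_rowSetoid [Fintype V] {p : ℕ} {τ : Matching (V × Fin p)} {a : V × Fin p → X}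
    (hc : τ.Connects Prod.fst) (ha : τ.Preserves a) :
    RowClasses τ a (Quotient.mk (rowSetoid a)) where
  preserves := ha
  connects := hc.comp _ Quotient.mk_surjective
  surjective := Quotient.mk_surjective
  rowImage_eq := fun _ _ h => RowEquiv.rowImage_eq (Quotient.exact h)

open Classical in
theorem sum_card_fiber [Fintype V] [Fintype ι] (c : V → ι) :
    ∑ i, (Finset.univ.filter fun v => c v = i).card = Fintype.card V := by
  rw [← Finset.card_univ (α := V)]
  exact (Finset.card_eq_sum_card_fiberwise (fun v _ => Finset.mem_univ (c v))).symm

open Classical in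
theorem two_le_card_fiber [Fintype V] {c : V → ι} (hc : Function.Surjective c)
    (h : ∀ v, ∃ v', v' ≠ v ∧ c v = c v') (i : ι) :
    2 ≤ (Finset.univ.filter fun v => c v = i).card := by
  obtain ⟨v, rfl⟩ := hc i
  obtain ⟨v', hv, hvv⟩ := h v
  exact Finset.one_lt_card.2 ⟨v, by simp, v', by simp [hvv], hv.symm⟩

theorem two_mul_card_le [Fintype V] [Fintype ι] {c : V → ι} (hc : Function.Surjective c)
    (h : ∀ v, ∃ v', v' ≠ v ∧ c v = c v') : 2 * Fintype.card ι ≤ Fintype.card V := by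
  classical
  rw [← sum_card_fiber c, mul_comm, ← smul_eq_mul, ← Finset.card_univ]
  exact Finset.card_nsmul_le_sum _ _ _ fun i _ => two_le_card_fiber hc h i

open Classical in
theorem card_fiber_eq_two [Fintype V] [Fintype ι] {c : V → ι} (hc : Function.Surjective c)
    (h : ∀ v, ∃ v', v' ≠ v ∧ c v = c v') (hV : Fintype.card V = 2 * Fintype.card ι) (i : ι) :
    (Finset.univ.filter fun v => c v = i).card = 2 := by
  have h1 : ∑ _i : ι, 2 = ∑ i, (Finset.univ.filter fun v => c v = i).card := by
    rw [sum_card_fiber, hV, Finset.sum_const, Finset.card_univ, smul_eq_mul, mul_comm]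
  have := (Finset.sum_eq_sum_iff_of_le fun i _ => two_le_card_fiber hc h i).1 h1
  exact (this i (Finset.mem_univ i)).symm

theorem exists_mk_rowSetoid_eq {p : ℕ} {a : V × Fin p → X}
    (h : ∀ v, ∃ v', v' ≠ v ∧ RowEquiv a v v') (v : V) :
    ∃ v', v' ≠ v ∧ Quotient.mk (rowSetoid a) v = Quotient.mk (rowSetoid a) v' :=
  (h v).imp fun _ hv => ⟨hv.1, Quotient.sound (s := rowSetoid a) hv.2⟩

/-- Classes have at least two rows, so there are K ≤ k of them and at most 1 + K(p-1) labels.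
Equality would make every class even, against the odd number of rows. -/
theorem imageCard_le_of_odd [Fintype V] {p k : ℕ} (hp : 2 ≤ p) (hV : Fintype.card V = 2 * k + 1)
    {τ : Matching (V × Fin p)} {a : V × Fin p → X}
    (hc : τ.Connects Prod.fst) (ha : τ.Preserves a)
    (h : ∀ v, ∃ v', v' ≠ v ∧ RowEquiv a v v') : imageCard a ≤ k * (p - 1) := by
  classical
  have hne : Nonempty V := Fintype.card_pos_iff.1 (by omega)
  have hne' : Nonempty (Quotient (rowSetoid a)) := hne.map (Quotient.mk _)
  have hR := rowClasses_rowSetoid hc ha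
  have h1 := hR.imageCard_add_card_le
  have h2 := two_mul_card_le hR.surjective (exists_mk_rowSetoid_eq h)
  have h3 : imageCard a + Fintype.card (Quotient (rowSetoid a)) ≠
      1 + Fintype.card (Quotient (rowSetoid a)) * p := by
    intro heq
    have h4 := (hR.of_card_eq hp heq).2.2 Finset.univ fun q _ => Finset.mem_univ _
    have h5 : Even (Fintype.card V) := by
      rw [← sum_card_fiber (Quotient.mk (rowSetoid a))]
      exact Finset.even_sum _ fun i _ => h4 i
    rw [hV] at h5
    exact (Nat.not_even_iff_odd.2 ⟨k, rfl⟩) h5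
  generalize Fintype.card (Quotient (rowSetoid a)) = K at *
  obtain ⟨q, rfl⟩ : ∃ q, p = q + 1 := ⟨p - 1, by omega⟩
  have hKk : K ≤ k := by omega
  have := Nat.mul_le_mul_right q hKk
  rw [Nat.mul_add] at h1 h3
  simp only [Nat.add_sub_cancel]
  omega

/-- So many labels force K = k classes and equality in the bound; 2k rows in k classes of size at
least two form pairs. -/
theorem injective_and_existsUnique_of_even [Fintype V] {p k : ℕ} (hp : 2 ≤ p) (hk : 0 < k)
    (hV : Fintype.card V = 2 * k) {τ : Matching (V × Fin p)} {a : V × Fin p → X}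
    (hc : τ.Connects Prod.fst) (ha : τ.Preserves a)
    (h : ∀ v, ∃ v', v' ≠ v ∧ RowEquiv a v v') (hcard : k * (p - 1) < imageCard a) :
    (∀ v, Function.Injective fun j => a (v, j)) ∧ ∀ v, ∃! v', v' ≠ v ∧ RowEquiv a v v' := by
  classical
  have hne : Nonempty V := Fintype.card_pos_iff.1 (by omega)
  have hne' : Nonempty (Quotient (rowSetoid a)) := hne.map (Quotient.mk _)
  have hR := rowClasses_rowSetoid hc ha
  have h1 := hR.imageCard_add_card_le
  have h2 := two_mul_card_le hR.surjective (exists_mk_rowSetoid_eq h)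
  have hK : Fintype.card (Quotient (rowSetoid a)) = k := by
    generalize Fintype.card (Quotient (rowSetoid a)) = K at *
    obtain ⟨q, rfl⟩ : ∃ q, p = q + 1 := ⟨p - 1, by omega⟩
    simp only [Nat.add_sub_cancel] at hcard
    rw [Nat.mul_add] at h1
    by_contra hne
    have hlt : K + 1 ≤ k := by omega
    have := Nat.mul_le_mul_right q hlt
    rw [Nat.add_mul] at this
    omega
  have heq : imageCard a + Fintype.card (Quotient (rowSetoid a)) =
      1 + Fintype.card (Quotient (rowSetoid a)) * p := by
    rw [hK] at h1 ⊢
    obtain ⟨q, rfl⟩ : ∃ q, p = q + 1 := ⟨p - 1, by omega⟩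
    simp only [Nat.add_sub_cancel] at hcard
    rw [Nat.mul_add] at h1 ⊢
    omega
  refine ⟨(hR.of_card_eq hp heq).1, fun v => ?_⟩
  obtain ⟨v', hv, hvv⟩ := h v
  refine ⟨v', ⟨hv, hvv⟩, ?_⟩
  rintro u ⟨hu, hvu⟩
  by_contra huv
  have h3 := card_fiber_eq_two hR.surjective (exists_mk_rowSetoid_eq h) (hV.trans (by rw [hK]))
    (Quotient.mk (rowSetoid a) v)
  have h4 : ({v, v', u} : Finset V) ⊆
      Finset.univ.filter fun w => Quotient.mk (rowSetoid a) w = Quotient.mk (rowSetoid a) v := by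
    intro w hw
    simp only [Finset.mem_insert, Finset.mem_singleton] at hw
    simp only [Finset.mem_filter, Finset.mem_univ, true_and]
    rcases hw with rfl | rfl | rfl
    · rfl
    · exact Quotient.sound (s := rowSetoid a) hvv.symm
    · exact Quotient.sound (s := rowSetoid a) hvu.symm
  have h5 := Finset.card_le_card h4
  rw [Finset.card_eq_three.2 ⟨v, v', u, hv.symm, hu.symm, Ne.symm huv, rfl⟩] at h5
  refine absurd h3 (ne_of_gt (lt_of_lt_of_le (by norm_num) (h5.trans_eq ?_)))
  congr!

/-- A matching of a set with `2 * k` elements splits it into `k` pairs. -/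
theorem Matching.exists_equiv [Fintype V] {k : ℕ} (hV : Fintype.card V = 2 * k) (w : Matching V) :
    ∃ e : V ≃ Fin k × Bool, ∀ v, e (w.1 v) = ((e v).1, !(e v).2) := by
  classical
  -- An arbitrary linear order selects one element of each pair.
  let o : LinearOrder V := LinearOrder.lift' (Fintype.equivFin V) (Fintype.equivFin V).injective
  have hlt : ∀ v, ¬ v < w.1 v → w.1 v < v := fun v h => lt_of_le_of_ne (not_lt.1 h) (w.2.2 v)
  let e₀ : V ≃ {v : V // v < w.1 v} × Bool :=
    { toFun := fun v => if h : v < w.1 v then (⟨v, h⟩, true)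
        else (⟨w.1 v, by rw [w.2.1]; exact hlt v h⟩, false)
      invFun := fun q => if q.2 then q.1.1 else w.1 q.1.1
      left_inv := fun v => by
        by_cases h : v < w.1 v
        · simp [h]
        · simp [h, w.2.1 v]
      right_inv := by
        rintro ⟨⟨v, hv⟩, b⟩
        cases b
        · simp [w.2.1 v, not_lt.2 hv.le]
        · simp [hv] }
  have hcard : Fintype.card {v : V // v < w.1 v} = k := by
    have := Fintype.card_congr e₀
    rw [hV, Fintype.card_prod, Fintype.card_bool] at this
    omega
  let e₁ : {v : V // v < w.1 v} ≃ Fin k := Fintype.equivFinOfCardEq hcard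
  refine ⟨e₀.trans (e₁.prodCongr (Equiv.refl Bool)), fun v => ?_⟩
  by_cases h : v < w.1 v
  · simp [e₀, h, w.2.1 v, not_lt.2 h.le]
  · simp [e₀, h, w.2.1 v, hlt v h]

/-- A choice of the decomposition of `V` into the pairs of a matching. -/
def Matching.pairs [Fintype V] {k : ℕ} (hV : Fintype.card V = 2 * k) (w : Matching V) :
    V ≃ Fin k × Bool := (w.exists_equiv hV).choose

theorem Matching.pairs_apply [Fintype V] {k : ℕ} (hV : Fintype.card V = 2 * k) (w : Matching V)
    (v : V) : w.pairs hV (w.1 v) = ((w.pairs hV v).1, !(w.pairs hV v).2) :=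
  (w.exists_equiv hV).choose_spec v

/-- The rows of each pair agree up to the given permutations. -/
def IsPaired {k p : ℕ} (e : V ≃ Fin k × Bool) (s : Fin k → Equiv.Perm (Fin p))
    (a : V × Fin p → X) : Prop :=
  ∀ i j, a (e.symm (i, true), j) = a (e.symm (i, false), s i j)

theorem IsPaired.rowEquiv [Fintype V] {k p : ℕ} (hV : Fintype.card V = 2 * k) {w : Matching V}
    {s : Fin k → Equiv.Perm (Fin p)} {a : V × Fin p → X} (h : IsPaired (w.pairs hV) s a) (v : V) :
    RowEquiv a v (w.1 v) := by
  have hv := w.pairs_apply hV v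
  have h1 : RowEquiv a ((w.pairs hV).symm ((w.pairs hV v).1, false))
      ((w.pairs hV).symm ((w.pairs hV v).1, true)) := ⟨s _, h _⟩
  have hv1 : v = (w.pairs hV).symm ((w.pairs hV v).1, (w.pairs hV v).2) := by simp
  have hv2 : w.1 v = (w.pairs hV).symm ((w.pairs hV v).1, !(w.pairs hV v).2) := by
    rw [← hv]; simp
  rw [hv2]
  nth_rewrite 1 [hv1]
  cases (w.pairs hV v).2
  · exact h1
  · exact h1.symm

open Classical in
/-- The number of ways to pair rows agreeing up to permutations. -/
def wickSum [Fintype V] {k p : ℕ} (hV : Fintype.card V = 2 * k) (a : V × Fin p → X) : ℝ :=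
  ∑ w : Matching V, ∑ s : Fin k → Equiv.Perm (Fin p), if IsPaired (w.pairs hV) s a then 1 else 0

theorem wickSum_eq_zero [Fintype V] {k p : ℕ} (hV : Fintype.card V = 2 * k) {a : V × Fin p → X}
    (h : ¬ ∀ v, ∃ v', v' ≠ v ∧ RowEquiv a v v') : wickSum hV a = 0 := by
  refine Finset.sum_eq_zero fun w _ => Finset.sum_eq_zero fun s _ => if_neg fun hs => ?_
  exact h fun v => ⟨w.1 v, w.2.2 v, hs.rowEquiv hV v⟩

/-- Uniqueness of the partner determines the matching, and distinct labels within a row determine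
the permutations. -/
theorem wickSum_eq_one [Fintype V] {k p : ℕ} (hV : Fintype.card V = 2 * k) {a : V × Fin p → X}
    (hinj : ∀ v, Function.Injective fun j => a (v, j))
    (h : ∀ v, ∃! v', v' ≠ v ∧ RowEquiv a v v') : wickSum hV a = 1 := by
  classical
  choose f hf hu using h
  let w : Matching V := ⟨f, fun v => ((hu (f v)) v ⟨(hf v).1.symm, (hf v).2.symm⟩).symm,
    fun v => (hf v).1⟩
  have hpair : ∀ i, ∃ s : Equiv.Perm (Fin p), ∀ j,
      a ((w.pairs hV).symm (i, true), j) = a ((w.pairs hV).symm (i, false), s j) := by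
    intro i
    have h1 := (hf ((w.pairs hV).symm (i, false))).2
    have h2 : f ((w.pairs hV).symm (i, false)) = (w.pairs hV).symm (i, true) := by
      rw [Equiv.eq_symm_apply]
      have := w.pairs_apply hV ((w.pairs hV).symm (i, false))
      simpa using this
    rw [h2] at h1
    exact h1
  choose s hs using hpair
  replace hs : IsPaired (w.pairs hV) s a := hs
  unfold wickSum
  rw [Finset.sum_eq_single w, Finset.sum_eq_single s, if_pos hs]
  · intro t _ hts
    refine if_neg fun ht => hts (funext fun i => Equiv.ext fun j => ?_)
    exact hinj _ ((ht i j).symm.trans (hs i j))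
  · simp
  · intro w' _ hw
    refine Finset.sum_eq_zero fun t _ => if_neg fun ht => hw (Subtype.ext (funext fun v => ?_))
    exact hu v _ ⟨w'.2.2 v, ht.rowEquiv hV v⟩
  · simp

theorem abs_wickSum_le [Fintype V] {k p : ℕ} (hV : Fintype.card V = 2 * k) (a : V × Fin p → X) :
    |wickSum hV a| ≤ Fintype.card (Matching V) * Fintype.card (Fin k → Equiv.Perm (Fin p)) := by
  classical
  unfold wickSum
  rw [← Fintype.sum_prod_type']
  refine (Finset.abs_sum_le_sum_abs _ _).trans
    ((Finset.sum_le_card_nsmul _ _ 1 fun q _ => ?_).trans ?_)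
  · split_ifs <;> simp
  · simp

end

/-! ### Asymptotics of sums over connected matchings. -/

section

variable {X V Q ι : Type}

/-- The rows of a pair put side by side, aligned by a permutation. -/
def alignEquiv {k p : ℕ} (e : V ≃ Fin k × Bool) (s : Fin k → Equiv.Perm (Fin p)) :
    V × Fin p ≃ (Fin k × Fin p) × Bool where
  toFun q := (((e q.1).1, bif (e q.1).2 then s (e q.1).1 q.2 else q.2), (e q.1).2)
  invFun r := (e.symm (r.1.1, r.2), bif r.2 then (s r.1.1).symm r.1.2 else r.1.2)
  left_inv := by
    rintro ⟨v, j⟩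
    obtain ⟨⟨i, b⟩, rfl⟩ := e.symm.surjective v
    cases b <;> simp
  right_inv := by
    rintro ⟨⟨i, j⟩, b⟩
    cases b <;> simp

theorem isPaired_iff {k p : ℕ} (e : V ≃ Fin k × Bool) (s : Fin k → Equiv.Perm (Fin p))
    (a : V × Fin p → X) :
    IsPaired e s a ↔ ∃ a' : Fin k × Fin p → X, a = a' ∘ Prod.fst ∘ alignEquiv e s := by
  constructor
  · intro h
    refine ⟨fun q => a (e.symm (q.1, false), q.2), funext fun ⟨v, j⟩ => ?_⟩
    obtain ⟨⟨i, b⟩, rfl⟩ := e.symm.surjective v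
    cases b
    · simp [alignEquiv]
    · simpa [alignEquiv] using h i j
  · rintro ⟨a', rfl⟩ i j
    simp [alignEquiv]

/-- The variant of `labelCount` where the matching has to connect the rows of the array. -/
def rowLabelCount (k p N : ℕ) : ℝ :=
  preservedCount (fun q : (Fin k × Fin p) × Bool => (q.1.1, q.2)) N

open Classical in
-- Once the rows of each pair are aligned, paired labellings are exactly those pulled back from a
-- single k × p array. The result no longer depends on `e` and `s`.
theorem sum_isPaired_eq [Fintype V] {k p : ℕ} (e : V ≃ Fin k × Bool)
    (s : Fin k → Equiv.Perm (Fin p)) (N : ℕ) :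
    (∑ τ : Matching (V × Fin p), ∑ a : V × Fin p → Fin N,
      if τ.Connects Prod.fst ∧ τ.Preserves a then (if IsPaired e s a then (1 : ℝ) else 0) else 0) =
      rowLabelCount k p N := by
  unfold rowLabelCount preservedCount
  refine Fintype.sum_equiv (Matching.congr (alignEquiv e s)) _ _ fun τ => ?_
  symm
  refine @Fintype.sum_of_injective _ _ _ (_) (_) _
    (fun a' : Fin k × Fin p → Fin N => a' ∘ Prod.fst ∘ alignEquiv e s) ?_ _ _ ?_ ?_
  · intro a b hab
    refine funext fun q => ?_
    have := congrFun hab ((alignEquiv e s).symm (q, true))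
    simpa using this
  · intro a ha
    rw [if_neg (c := IsPaired e s a), ite_self]
    rw [isPaired_iff]
    rintro ⟨a', rfl⟩
    exact ha ⟨a', rfl⟩
  · intro a
    rw [if_pos (c := IsPaired e s _) ((isPaired_iff e s _).2 ⟨a, rfl⟩), Matching.congr_connects,
      Matching.congr_preserves]
    have h1 : τ.Connects ((fun q : (Fin k × Fin p) × Bool => (q.1.1, q.2)) ∘ alignEquiv e s) ↔
        τ.Connects Prod.fst := by
      have h2 : (fun q : (Fin k × Fin p) × Bool => (q.1.1, q.2)) ∘ alignEquiv e s =
          e ∘ Prod.fst := by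
        ext q <;> simp [alignEquiv]
      rw [h2]
      constructor
      · intro h
        have := h.comp e.symm e.symm.surjective
        rwa [← Function.comp_assoc, Equiv.symm_comp_self, Function.id_comp] at this
      · exact fun h => h.comp e e.surjective
    rw [h1]
    rfl

/-- The two copies of a row form one class. With more labels the bound on the classes would be
attained, and parity applied to a union of components would put both copies of each row in the same
component; connectedness of the pairs would then give that of the rows. -/
theorem imageCard_le_of_not_connects {k p : ℕ} (hp : 2 ≤ p) (hk : 0 < k)
    {τ : Matching ((Fin k × Fin p) × Bool)} {a : Fin k × Fin p → X}
    (h1 : τ.Connects fun q => q.1.1) (h2 : ¬ τ.Connects fun q => (q.1.1, q.2))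
    (h3 : τ.Preserves (a ∘ Prod.fst)) : imageCard a ≤ k * (p - 1) := by
  classical
  let e : (Fin k × Fin p) × Bool ≃ (Fin k × Bool) × Fin p :=
    { toFun := fun q => ((q.1.1, q.2), q.1.2)
      invFun := fun q => ((q.1.1, q.2), q.1.2)
      left_inv := fun _ => rfl
      right_inv := fun _ => rfl }
  let a' : (Fin k × Bool) × Fin p → X := fun q => a (q.1.1, q.2)
  have hne : Nonempty (Fin k) := ⟨⟨0, hk⟩⟩
  have hR : RowClasses (Matching.congr e τ) a' Prod.fst :=
    { preserves := (Matching.congr_preserves e τ _).2 h3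
      connects := (Matching.congr_connects e τ _).2 h1
      surjective := Prod.fst_surjective
      rowImage_eq := by
        rintro ⟨i, b⟩ ⟨i', b'⟩ h
        obtain rfl : i = i' := h
        rfl }
  have him : imageCard a' = imageCard a := by
    unfold imageCard
    congr 1
    ext x
    simp only [Finset.mem_image, Finset.mem_univ, true_and, Prod.exists, a']
    exact ⟨fun ⟨i, _, j, h⟩ => ⟨i, j, h⟩, fun ⟨i, j, h⟩ => ⟨i, true, j, h⟩⟩
  have h4 := hR.imageCard_add_card_le
  have h5 : imageCard a' + Fintype.card (Fin k) ≠ 1 + Fintype.card (Fin k) * p := by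
    intro heq
    refine h2 fun f hf => ?_
    have h6 := (hR.of_card_eq hp heq).2.2 (Finset.univ.filter fun v => f v = true) (fun q hq => by
      simp only [Finset.mem_filter, Finset.mem_univ, true_and] at hq ⊢
      rw [← hq]
      exact hf (e.symm q))
    have h7 : ∀ i, f (i, true) = f (i, false) := by
      intro i
      have h8 := h6 i
      rw [Finset.filter_filter, Finset.card_filter, Fintype.sum_prod_type,
        Finset.sum_eq_single i] at h8
      · rw [Fintype.sum_bool] at h8
        rcases ht : f (i, true) <;> rcases hf : f (i, false) <;>
          simp only [ht, hf, reduceCtorEq, and_true, if_true, if_false] at h8 ⊢ <;>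
          exact absurd h8 (by decide)
      · intro j _ hj
        simp [hj]
      · simp
    have h9 : ∀ v, f v = f (v.1, true) := by
      rintro ⟨i, b⟩
      cases b
      · exact (h7 i).symm
      · rfl
    have h10 := h1 (fun i => f (i, true)) (fun q => by
      have := hf q
      simp only [Function.comp_apply] at this ⊢
      rw [h9, h9 (q.1.1, q.2)] at this
      exact this)
    intro u v
    rw [h9 u, h9 v]
    exact h10 _ _
  rw [him, Fintype.card_fin] at h4 h5
  obtain ⟨q, rfl⟩ : ∃ q, p = q + 1 := ⟨p - 1, by omega⟩
  rw [Nat.mul_add] at h4 h5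
  simp only [Nat.add_sub_cancel]
  omega

theorem isBigO_pow_of_abs_le {f : ℕ → ℝ} {C : ℝ} {R : ℕ}
    (h : ∀ N : ℕ, 1 ≤ N → |f N| ≤ C * (N : ℝ) ^ R) :
    f =O[atTop] fun N : ℕ => (N : ℝ) ^ R := by
  refine IsBigO.of_bound C ?_
  filter_upwards [eventually_ge_atTop 1] with N hN
  rw [Real.norm_eq_abs, Real.norm_of_nonneg (by positivity)]
  exact h N hN

/-- The recursion computes connectedness of the pairs of rows, while maps need connectedness of the
rows; the two differ only on labellings with few labels. -/
theorem labelCount_sub_rowLabelCount_isBigO {k p : ℕ} (hp : 2 ≤ p) (hk : 0 < k) :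
    (fun N : ℕ => labelCount (Prod.fst : Fin k × Fin p → Fin k) N - rowLabelCount k p N) =O[atTop]
      fun N : ℕ => (N : ℝ) ^ (k * (p - 1)) := by
  classical
  unfold labelCount rowLabelCount preservedCount
  simp only [← Finset.sum_sub_distrib]
  refine IsBigO.fun_sum fun τ _ => ?_
  refine isBigO_pow_of_abs_le
    (C := 1 * ((k * (p - 1) : ℕ) : ℝ) ^ Fintype.card (Fin k × Fin p)) fun N hN => ?_
  refine @abs_sum_le_of_imageCard_le _ _ _ _ (_) hN _ _ (fun a => ?_) fun a ha => ?_
  · split_ifs <;> simp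
  · by_cases h1 : τ.Connects fun q => (q.1.1, q.2)
    · have h2 : τ.Connects (Prod.fst ∘ Prod.fst) := h1.comp Prod.fst Prod.fst_surjective
      simp [h1, h2]
    · by_cases h2 : τ.Connects (Prod.fst ∘ Prod.fst) ∧ τ.Preserves (a ∘ Prod.fst)
      · exact absurd (imageCard_le_of_not_connects hp hk h2.1 h1 h2.2) (not_le.2 ha)
      · simp [h1, h2]

theorem rowLabelCount_isBigO {k p : ℕ} (hp : 2 ≤ p) (hk : 0 < k) :
    (fun N : ℕ => rowLabelCount k p N -
      blockCoeff (Prod.fst : Fin k × Fin p → Fin k) * (N : ℝ) ^ (k * (p - 1) + 1)) =O[atTop]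
      fun N : ℕ => (N : ℝ) ^ (k * (p - 1)) := by
  have hne : Nonempty (Fin k) := ⟨⟨0, hk⟩⟩
  have h1 := labelCount_isBigO (Prod.fst : Fin k × Fin p → Fin k)
  have h2 := (isBigO_refl (fun N : ℕ => ((N : ℝ) ^ k)⁻¹) atTop).mul h1
  have hkp : Fintype.card (Fin k × Fin p) = k * (p - 1) + k := by
    obtain ⟨q, rfl⟩ : ∃ q, p = q + 1 := ⟨p - 1, by omega⟩
    simp; ring
  have h3 : (fun N : ℕ => labelCount (Prod.fst : Fin k × Fin p → Fin k) N -
      blockCoeff (Prod.fst : Fin k × Fin p → Fin k) * (N : ℝ) ^ (k * (p - 1) + 1)) =O[atTop]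
      fun N : ℕ => (N : ℝ) ^ (k * (p - 1)) := by
    refine h2.congr' ?_ ?_
    · filter_upwards [eventually_ge_atTop 1] with N hN
      have : (N : ℝ) ≠ 0 := by positivity
      rw [hkp, Fintype.card_fin]
      field_simp
      ring
    · filter_upwards [eventually_ge_atTop 1] with N hN
      have : (N : ℝ) ≠ 0 := by positivity
      rw [hkp]
      field_simp
      ring
  refine (h3.sub (labelCount_sub_rowLabelCount_isBigO hp hk)).congr_left fun N => ?_
  ring

open Classical in
/-- The sum of a function of labellings over the connected matchings and the labellings they
preserve. -/
def matchingSum [Fintype V] {p N : ℕ} (g : (V × Fin p → Fin N) → ℝ) : ℝ :=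
  ∑ τ : Matching (V × Fin p), ∑ a : V × Fin p → Fin N,
    if τ.Connects Prod.fst ∧ τ.Preserves a then g a else 0

/-- A uniformly bounded family of functions of labellings with the combinatorial properties of the
moments of a product of centered independent entries of variance `c`. -/
structure IsMomentLike [Fintype V] {p : ℕ} (c : ℝ)
    (g : ∀ N : ℕ, (V × Fin p → Fin N) → ℝ) : Prop where
  bounded : ∃ C, ∀ N, 1 ≤ N → ∀ a, |g N a| ≤ C
  eq_zero : ∀ N, 1 ≤ N → ∀ a, (¬ ∀ v, ∃ v', v' ≠ v ∧ RowEquiv a v v') → g N a = 0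
  eq_pow : ∀ N, 1 ≤ N → ∀ a, (∀ v, Function.Injective fun j => a (v, j)) →
    (∀ v, ∃! v', v' ≠ v ∧ RowEquiv a v v') → ∀ k, Fintype.card V = 2 * k → g N a = c ^ k

theorem IsMomentLike.isBigO_of_odd [Fintype V] {p k : ℕ} (hp : 2 ≤ p) {c : ℝ}
    {g : ∀ N : ℕ, (V × Fin p → Fin N) → ℝ} (hg : IsMomentLike c g)
    (hV : Fintype.card V = 2 * k + 1) :
    (fun N => matchingSum (g N)) =O[atTop] fun N : ℕ => (N : ℝ) ^ (k * (p - 1)) := by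
  classical
  obtain ⟨C, hC⟩ := hg.bounded
  unfold matchingSum
  refine IsBigO.fun_sum fun τ _ => ?_
  refine isBigO_pow_of_abs_le
    (C := C * ((k * (p - 1) : ℕ) : ℝ) ^ Fintype.card (V × Fin p)) fun N hN => ?_
  refine abs_sum_le_of_imageCard_le hN _ (fun a => ?_) fun a ha => ?_
  · split_ifs
    · exact hC N hN a
    · rw [abs_zero]
      exact (abs_nonneg _).trans (hC N hN a)
  · split_ifs with h
    · refine hg.eq_zero N hN a fun h' => ?_
      exact absurd (imageCard_le_of_odd hp hV h.1 h.2 h') (not_le.2 ha)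
    · rfl

theorem matchingSum_wickSum [Fintype V] {p k : ℕ} (hV : Fintype.card V = 2 * k) (N : ℕ) :
    matchingSum (fun a : V × Fin p → Fin N => wickSum hV a) =
      Fintype.card (Matching V) * (p.factorial : ℝ) ^ k * rowLabelCount k p N := by
  classical
  have h1 : matchingSum (fun a : V × Fin p → Fin N => wickSum hV a) =
      ∑ w : Matching V, ∑ s : Fin k → Equiv.Perm (Fin p),
      ∑ τ : Matching (V × Fin p), ∑ a : V × Fin p → Fin N,
      if τ.Connects Prod.fst ∧ τ.Preserves a then
        (if IsPaired (w.pairs hV) s a then (1 : ℝ) else 0) else 0 := by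
    unfold matchingSum wickSum
    rw [← Fintype.sum_prod_type', ← Fintype.sum_prod_type']
    simp only [← Fintype.sum_prod_type' (f := fun (w : Matching V)
      (s : Fin k → Equiv.Perm (Fin p)) => if IsPaired (w.pairs hV) s _ then (1 : ℝ) else 0)]
    simp only [← Fintype.sum_prod_type' (f := fun (τ : Matching (V × Fin p))
      (a : V × Fin p → Fin N) => if τ.Connects Prod.fst ∧ τ.Preserves a then
        (if IsPaired _ _ a then (1 : ℝ) else 0) else 0)]
    rw [Finset.sum_comm]
    refine Finset.sum_congr rfl fun τ _ => ?_
    split_ifs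
    · rfl
    · simp
  rw [h1]
  simp only [sum_isPaired_eq, Finset.sum_const, Finset.card_univ, nsmul_eq_mul]
  simp [Fintype.card_perm, mul_assoc]

/-- On labellings with more than k(p-1) labels, `g` equals c^k times `wickSum`: both vanish, or the
rows are paired uniquely. Elsewhere both are bounded, so the difference is an error term. -/
theorem IsMomentLike.isBigO_of_even [Fintype V] {p k : ℕ} (hp : 2 ≤ p) (hk : 0 < k) {c : ℝ}
    {g : ∀ N : ℕ, (V × Fin p → Fin N) → ℝ} (hg : IsMomentLike c g)
    (hV : Fintype.card V = 2 * k) :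
    (fun N => matchingSum (g N) - c ^ k * (Fintype.card (Matching V) * (p.factorial : ℝ) ^ k *
      blockCoeff (Prod.fst : Fin k × Fin p → Fin k)) * (N : ℝ) ^ (k * (p - 1) + 1)) =O[atTop]
      fun N : ℕ => (N : ℝ) ^ (k * (p - 1)) := by
  classical
  obtain ⟨C, hC⟩ := hg.bounded
  have h1 : (fun N => matchingSum (g N) - c ^ k *
      matchingSum (fun a : V × Fin p → Fin N => wickSum hV a)) =O[atTop]
      fun N : ℕ => (N : ℝ) ^ (k * (p - 1)) := by
    unfold matchingSum
    simp only [Finset.mul_sum, ← Finset.sum_sub_distrib]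
    refine IsBigO.fun_sum fun τ _ => ?_
    refine isBigO_pow_of_abs_le (C := (C + |c ^ k| * (Fintype.card (Matching V) *
      Fintype.card (Fin k → Equiv.Perm (Fin p)))) *
      ((k * (p - 1) : ℕ) : ℝ) ^ Fintype.card (V × Fin p)) fun N hN => ?_
    refine abs_sum_le_of_imageCard_le hN _ (fun a => ?_) fun a ha => ?_
    · split_ifs
      · refine (abs_sub _ _).trans (add_le_add (hC N hN a) ?_)
        rw [abs_mul]
        exact mul_le_mul_of_nonneg_left (abs_wickSum_le hV a) (abs_nonneg _)
      · have := (abs_nonneg _).trans (hC N hN a)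
        rw [mul_zero, sub_zero, abs_zero]
        positivity
    · split_ifs with h
      · by_cases h' : ∀ v, ∃ v', v' ≠ v ∧ RowEquiv a v v'
        · obtain ⟨h2, h3⟩ := injective_and_existsUnique_of_even hp hk hV h.1 h.2 h' ha
          rw [hg.eq_pow N hN a h2 h3 k hV, wickSum_eq_one hV h2 h3]
          ring
        · rw [hg.eq_zero N hN a h', wickSum_eq_zero hV h']
          ring
      · ring
  have h2 := (rowLabelCount_isBigO hp hk).const_mul_left
    (c ^ k * (Fintype.card (Matching V) * (p.factorial : ℝ) ^ k))
  refine (h1.add h2).congr_left fun N => ?_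
  rw [matchingSum_wickSum]
  ring

end

/-! ### Moments of products of Wigner entries. -/

section

variable {V : Type}

/-- The sorted entries of a row. -/
def rowKey {p N : ℕ} (a : V × Fin p → Fin N) (v : V) : {i : Fin p → Fin N // Monotone i} :=
  ⟨(fun j => a (v, j)) ∘ Tuple.sort fun j => a (v, j), Tuple.monotone_sort _⟩

theorem rowKey_eq_iff {p N : ℕ} (a : V × Fin p → Fin N) (v v' : V) :
    rowKey a v = rowKey a v' ↔ RowEquiv a v v' := by
  rw [Subtype.ext_iff]
  constructor
  · intro h
    refine ⟨Tuple.sort (fun j => a (v, j)) * (Tuple.sort fun j => a (v', j))⁻¹, fun j => ?_⟩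
    have := congrFun h ((Tuple.sort fun j => a (v', j))⁻¹ j)
    simpa [rowKey] using this.symm
  · rintro ⟨s, hs⟩
    have : (fun j => a (v', j)) = (fun j => a (v, j)) ∘ s := funext hs
    simp only [rowKey, this]
    exact Tuple.comp_perm_comp_sort_eq_comp_sort.symm

theorem SymTensor.apply_rowKey {p N : ℕ} (T : SymTensor p N) (a : V × Fin p → Fin N) (v : V) :
    T.1 (rowKey a v).1 = T.1 fun j => a (v, j) :=
  T.2 (fun j => a (v, j)) (Tuple.sort fun j => a (v, j))

/-- All factors are bounded by the largest one, which replaces Hölder's inequality. -/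
theorem abs_prod_le_sum_pow_card [Fintype V] [Nonempty V] (x : V → ℝ) :
    |∏ v, x v| ≤ ∑ v, |x v| ^ Fintype.card V := by
  obtain ⟨v₀, -, h₀⟩ := Finset.exists_max_image Finset.univ (fun v => |x v|) Finset.univ_nonempty
  rw [Finset.abs_prod]
  refine (Finset.prod_le_prod (fun v _ => abs_nonneg (x v)) fun v hv => h₀ v hv).trans ?_
  rw [Finset.prod_const, Finset.card_univ]
  exact Finset.single_le_sum (f := fun v => |x v| ^ Fintype.card V) (fun v _ => by positivity)
    (Finset.mem_univ v₀)

namespace HasWignerEntries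

variable {Ω : Type*} [MeasurableSpace Ω] {p N : ℕ} {P : Measure Ω} {T : Ω → SymTensor p N}

theorem integrable_prod [Fintype V] [Nonempty V] (h : HasWignerEntries P T) (i : V → Fin p → Fin N) :
    Integrable (fun ω => ∏ v, (T ω).1 (i v)) P := by
  refine (integrable_finsetSum Finset.univ fun v _ =>
    h.moments (i v) (Fintype.card V)).mono' ?_ (Eventually.of_forall fun ω => ?_)
  · exact (Finset.measurable_fun_prod _ fun v _ => h.measurable (i v)).aestronglyMeasurable
  · exact abs_prod_le_sum_pow_card _

theorem abs_integral_prod_le [Fintype V] [Nonempty V] (h : HasWignerEntries P T) {C : ℝ}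
    (hC : ∀ i, ∫ ω, |(T ω).1 i| ^ Fintype.card V ∂P ≤ C) (i : V → Fin p → Fin N) :
    |∫ ω, ∏ v, (T ω).1 (i v) ∂P| ≤ Fintype.card V * C := by
  refine abs_integral_le_integral_abs.trans ?_
  have h1 : ∫ ω, |∏ v, (T ω).1 (i v)| ∂P ≤ ∫ ω, ∑ v, |(T ω).1 (i v)| ^ Fintype.card V ∂P :=
    integral_mono (h.integrable_prod i).abs (integrable_finsetSum Finset.univ fun v _ =>
      h.moments (i v) (Fintype.card V)) fun ω => abs_prod_le_sum_pow_card _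
  refine h1.trans ?_
  rw [integral_finsetSum _ fun v _ => h.moments (i v) (Fintype.card V)]
  refine (Finset.sum_le_card_nsmul _ _ C fun v _ => hC (i v)).trans ?_
  rw [nsmul_eq_mul, Finset.card_univ]

open Classical in
-- By symmetry each factor equals the entry at the sorted row; factors with the same sorted row are
-- collected into a power before independence is used.
theorem integral_prod_eq [Fintype V] (h : HasWignerEntries P T) (a : V × Fin p → Fin N) :
    ∫ ω, ∏ v, (T ω).1 (fun j => a (v, j)) ∂P = ∏ κ : {i : Fin p → Fin N // Monotone i},
      ∫ ω, (T ω).1 κ.1 ^ (Finset.univ.filter fun v => rowKey a v = κ).card ∂P := by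
  have h1 : ∀ ω, ∏ v, (T ω).1 (fun j => a (v, j)) = ∏ κ : {i : Fin p → Fin N // Monotone i},
      (T ω).1 κ.1 ^ (Finset.univ.filter fun v => rowKey a v = κ).card := by
    intro ω
    rw [← Finset.prod_fiberwise Finset.univ (rowKey a)]
    refine Finset.prod_congr rfl fun κ _ => ?_
    rw [← Finset.prod_const]
    refine Finset.prod_congr rfl fun v hv => ?_
    rw [← SymTensor.apply_rowKey, (Finset.mem_filter.1 hv).2]
  simp only [h1]
  exact h.indep.integral_fun_prod_comp
    (f := fun κ x => x ^ (Finset.univ.filter fun v => rowKey a v = κ).card)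
    (fun κ => (h.measurable κ.1).aemeasurable)
    (fun κ => (measurable_id.pow_const _).aestronglyMeasurable)

theorem integral_prod_eq_zero [Fintype V] (h : HasWignerEntries P T) {a : V × Fin p → Fin N}
    (ha : ¬ ∀ v, ∃ v', v' ≠ v ∧ RowEquiv a v v') :
    ∫ ω, ∏ v, (T ω).1 (fun j => a (v, j)) ∂P = 0 := by
  classical
  push Not at ha
  obtain ⟨v, hv⟩ := ha
  rw [h.integral_prod_eq]
  refine Finset.prod_eq_zero (Finset.mem_univ (rowKey a v)) ?_
  have : (Finset.univ.filter fun v' => rowKey a v' = rowKey a v) = {v} := by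
    ext v'
    simp only [Finset.mem_filter, Finset.mem_univ, true_and, Finset.mem_singleton]
    refine ⟨fun h' => ?_, fun h' => by rw [h']⟩
    by_contra hne
    exact hv v' hne ((rowKey_eq_iff a v v').1 h'.symm)
  rw [this, Finset.card_singleton]
  simp only [pow_one]
  exact h.centered _

/-- Every sorted row that occurs does so exactly twice, so there are k of them, and each contributes
the variance of an entry with distinct indices. -/
theorem integral_prod_eq_pow [Fintype V] (h : HasWignerEntries P T) {a : V × Fin p → Fin N}
    (hinj : ∀ v, Function.Injective fun j => a (v, j))
    (ha : ∀ v, ∃! v', v' ≠ v ∧ RowEquiv a v v') {k : ℕ} (hk : Fintype.card V = 2 * k) :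
    ∫ ω, ∏ v, (T ω).1 (fun j => a (v, j)) ∂P = (1 / ((p - 1).factorial : ℝ)) ^ k := by
  classical
  have := h.indep.isProbabilityMeasure
  have hcard : ∀ κ, (Finset.univ.filter fun v => rowKey a v = κ).card =
      if κ ∈ Set.range (rowKey a) then 2 else 0 := by
    intro κ
    split_ifs with hκ
    · obtain ⟨v, rfl⟩ := hκ
      obtain ⟨v', ⟨hv, hvv⟩, hu⟩ := ha v
      rw [Finset.card_eq_two]
      refine ⟨v, v', hv.symm, ?_⟩
      ext u
      simp only [Finset.mem_filter, Finset.mem_univ, true_and, Finset.mem_insert,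
        Finset.mem_singleton]
      constructor
      · intro hu'
        by_cases huv : u = v
        · exact Or.inl huv
        · exact Or.inr (hu u ⟨huv, (rowKey_eq_iff a v u).1 hu'.symm⟩)
      · rintro (rfl | rfl)
        · rfl
        · exact ((rowKey_eq_iff a v u).2 hvv).symm
    · rw [Finset.card_eq_zero, Finset.filter_eq_empty_iff]
      exact fun v _ hv => hκ ⟨v, hv⟩
  rw [h.integral_prod_eq]
  have hfac : ∀ κ : {i : Fin p → Fin N // Monotone i},
      ∫ ω, (T ω).1 κ.1 ^ (Finset.univ.filter fun v => rowKey a v = κ).card ∂P =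
      if κ ∈ Set.range (rowKey a) then 1 / ((p - 1).factorial : ℝ) else 1 := by
    intro κ
    rw [hcard]
    split_ifs with hκ
    · obtain ⟨v, rfl⟩ := hκ
      exact h.variance _ ((hinj v).comp (Equiv.injective _))
    · simp
  simp only [hfac]
  rw [Finset.prod_ite, Finset.prod_const, Finset.prod_const_one, mul_one]
  congr 1
  have hsum : ∑ κ, (Finset.univ.filter fun v => rowKey a v = κ).card = Fintype.card V := by
    rw [← Finset.card_univ (α := V)]
    exact (Finset.card_eq_sum_card_fiberwise (fun v _ => Finset.mem_univ (rowKey a v))).symm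
  simp only [hcard] at hsum
  rw [Finset.sum_ite, Finset.sum_const, Finset.sum_const_zero, add_zero, hk, smul_eq_mul] at hsum
  omega

end HasWignerEntries

/-- The moments of the products of entries of Wigner tensors. -/
theorem isMomentLike_integral_prod [Fintype V] [Nonempty V] {p : ℕ} {Ω : ℕ → Type*}
    [∀ N, MeasurableSpace (Ω N)] {P : ∀ N, Measure (Ω N)} {T : ∀ N, Ω N → SymTensor p N}
    (hT : ∀ N, 1 ≤ N → HasWignerEntries (P N) (T N))
    (hC : ∀ k : ℕ, ∃ C : ℝ, ∀ N, 1 ≤ N → ∀ i, ∫ ω, |(T N ω).1 i| ^ k ∂(P N) ≤ C) :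
    IsMomentLike (V := V) (1 / ((p - 1).factorial : ℝ)) fun N a =>
      ∫ ω, ∏ v, (T N ω).1 (fun j => a (v, j)) ∂(P N) where
  bounded := by
    obtain ⟨C, hC⟩ := hC (Fintype.card V)
    exact ⟨Fintype.card V * C, fun N hN a => (hT N hN).abs_integral_prod_le (hC N hN) _⟩
  eq_zero := fun N hN _ ha => (hT N hN).integral_prod_eq_zero ha
  eq_pow := fun N hN _ h1 h2 _ hk => (hT N hN).integral_prod_eq_pow h1 h2 hk

end

/-! ### From unlabelled maps to permutations and matchings. -/

section

variable {Q : Type}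

namespace CombMap

/-- The matching of the halfedges given by the edges. -/
def toMatching (b : CombMap Q) : Matching Q := ⟨b.τ, b.τ_invol, b.τ_ne⟩

/-- The combinatorial map given by a permutation and a matching. -/
def ofMatching (σ : Equiv.Perm Q) (τ : Matching Q) : CombMap Q where
  σ := σ
  τ := Function.Involutive.toPerm τ.1 τ.2.1
  τ_invol := τ.2.1
  τ_ne := τ.2.2

theorem toMatching_ofMatching (σ : Equiv.Perm Q) (τ : Matching Q) :
    (ofMatching σ τ).toMatching = τ := rfl

theorem ofMatching_toMatching (b : CombMap Q) : ofMatching b.σ b.toMatching = b := by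
  cases b
  simp only [ofMatching, toMatching, mk.injEq, true_and]
  ext q
  rfl

theorem vertexOf_surjective (b : CombMap Q) : Function.Surjective b.vertexOf :=
  fun v => ⟨b.rep v, b.vertexOf_rep v⟩

theorem connects_of_connected {b : CombMap Q} (h : b.graph.Connected) :
    b.toMatching.Connects b.vertexOf := by
  intro f hf u v
  obtain ⟨w⟩ := h.preconnected u v
  induction w with
  | nil => rfl
  | cons hadj _ ih =>
    rw [← ih]
    obtain ⟨-, ⟨q, rfl, rfl⟩ | ⟨q, rfl, rfl⟩⟩ := (SimpleGraph.fromRel_adj _ _ _).1 hadj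
    · exact (hf q).symm
    · exact hf q

theorem connected_of_connects [Nonempty Q] {b : CombMap Q}
    (h : b.toMatching.Connects b.vertexOf) : b.graph.Connected := by
  classical
  have hne : Nonempty b.Vertex := ‹Nonempty Q›.map b.vertexOf
  refine ⟨fun u v => ?_⟩
  have hstep : ∀ q, b.graph.Reachable (b.vertexOf q) (b.vertexOf (b.τ q)) := by
    intro q
    by_cases hq : b.vertexOf q = b.vertexOf (b.τ q)
    · rw [← hq]
    · exact ((SimpleGraph.fromRel_adj _ _ _).2 ⟨hq, Or.inl ⟨q, rfl, rfl⟩⟩).reachable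
  have := h (fun w => decide (b.graph.Reachable u w)) (fun q => by
    simp only [Function.comp_apply, decide_eq_decide]
    exact ⟨fun h' => h'.trans (hstep q).symm, fun h' => h'.trans (hstep q)⟩) u v
  simpa using this

theorem connected_iff [Nonempty Q] (b : CombMap Q) :
    b.graph.Connected ↔ b.toMatching.Connects b.vertexOf :=
  ⟨connects_of_connected, connected_of_connects⟩

theorem vertexOf_eq_iff (b : CombMap Q) (q q' : Q) :
    b.vertexOf q = b.vertexOf q' ↔ b.σ.SameCycle q q' :=
  ⟨fun h => Quotient.exact h, fun h => Quotient.sound (s := Equiv.Perm.SameCycle.setoid b.σ) h⟩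

/-- A relabelling of a connected map fixing a halfedge is trivial. -/
theorem IsRelabelling.eq_one [Finite Q] {b : CombMap Q} (hb : b.graph.Connected) {θ : Equiv.Perm Q}
    (h : IsRelabelling θ b b) {r : Q} (hr : θ r = r) : θ = 1 := by
  classical
  have hσ : ∀ q, θ (b.σ q) = b.σ (θ q) := fun q => by
    have := congrArg (fun s : Equiv.Perm Q => s (θ q)) h.1
    simpa using this.symm
  have hτ : ∀ q, θ (b.τ q) = b.τ (θ q) := fun q => by
    have := congrArg (fun s : Equiv.Perm Q => s (θ q)) h.2
    simpa using this.symm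
  have hpow : ∀ (m : ℕ) q, θ q = q → θ ((b.σ ^ m) q) = (b.σ ^ m) q := by
    intro m q hq
    induction m with
    | zero => simpa using hq
    | succ m ih => rw [pow_succ', Equiv.Perm.mul_apply, hσ, ih]
  have hcyc : ∀ q q', b.σ.SameCycle q q' → θ q = q → θ q' = q' := by
    intro q q' hq h'
    obtain ⟨m, rfl⟩ := hq.exists_nat_pow_eq
    exact hpow m q h'
  have hrep : ∀ q, θ (b.rep (b.vertexOf q)) = b.rep (b.vertexOf q) ↔ θ q = q := by
    intro q
    have := (b.vertexOf_eq_iff _ _).1 (b.vertexOf_rep (b.vertexOf q))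
    exact ⟨hcyc _ _ this, hcyc _ _ this.symm⟩
  -- Since `θ` commutes with `σ` and `τ`, the halfedges it fixes form full `σ`-cycles and are stable
  -- under `τ`; connectedness extends this set from the root to everything.
  have hc := connects_of_connected hb (fun v => decide (θ (b.rep v) = b.rep v)) (fun q => by
    simp only [Function.comp_apply, decide_eq_decide, hrep]
    change θ (b.τ q) = b.τ q ↔ _
    rw [hτ, b.τ.injective.eq_iff])
  ext q
  have := hc (b.vertexOf q) (b.vertexOf r)
  simp only [decide_eq_decide, hrep] at this
  exact this.2 hr

/-- The map obtained by relabelling the halfedges. -/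
def relabel (θ : Equiv.Perm Q) (b : CombMap Q) : CombMap Q where
  σ := θ * b.σ * θ⁻¹
  τ := θ * b.τ * θ⁻¹
  τ_invol := fun q => by simp [b.τ_invol]
  τ_ne := fun q h => b.τ_ne (θ⁻¹ q) (by
    rw [Equiv.Perm.mul_apply, Equiv.Perm.mul_apply] at h
    rw [Equiv.Perm.eq_inv_iff_eq, h])

theorem isRelabelling_relabel (θ : Equiv.Perm Q) (b : CombMap Q) :
    IsRelabelling θ b (b.relabel θ) := ⟨rfl, rfl⟩

theorem IsRegular.relabel {b : CombMap Q} {p : ℕ} (hb : b.IsRegular p) (θ : Equiv.Perm Q) :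
    (b.relabel θ).IsRegular p := by
  intro q
  rw [← hb (θ⁻¹ q), Function.minimalPeriod_eq_minimalPeriod_iff]
  intro m
  have : ((b.relabel θ).σ)^[m] q = θ ((b.σ)^[m] (θ⁻¹ q)) := by
    rw [← Equiv.Perm.coe_pow, ← Equiv.Perm.coe_pow]
    change ((θ * b.σ * θ⁻¹) ^ m) q = _
    rw [conj_pow]
    rfl
  rw [Function.IsPeriodicPt, Function.IsFixedPt, this, Function.IsPeriodicPt, Function.IsFixedPt,
    Equiv.Perm.eq_inv_iff_eq]

theorem connected_relabel [Nonempty Q] {b : CombMap Q} (hb : b.graph.Connected)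
    (θ : Equiv.Perm Q) : (b.relabel θ).graph.Connected := by
  rw [connected_iff] at hb ⊢
  have h1 : (b.relabel θ).toMatching = Matching.congr θ b.toMatching := rfl
  let g : b.Vertex → (b.relabel θ).Vertex := Quotient.map θ fun x y (h : b.σ.SameCycle x y) => by
    change (θ * b.σ * θ⁻¹).SameCycle (θ x) (θ y)
    rw [Equiv.Perm.sameCycle_conj]
    simpa using h
  have hg : g ∘ b.vertexOf = (b.relabel θ).vertexOf ∘ θ := rfl
  rw [h1, Matching.congr_connects, ← hg]
  refine hb.comp g fun v => ?_
  obtain ⟨q, rfl⟩ := (b.relabel θ).vertexOf_surjective v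
  exact ⟨b.vertexOf (θ⁻¹ q), by
    change (b.relabel θ).vertexOf (θ (θ⁻¹ q)) = _
    simp⟩

end CombMap

instance (p n : ℕ) : Fintype (RootedMap p n) := Fintype.ofFinite _

theorem RootedMap.ext {p n : ℕ} {b c : RootedMap p n} (h : b.map = c.map) (h' : b.root = c.root) :
    b = c := by
  cases b; cases c; simp_all

/-- The rooted map obtained by relabelling the halfedges. -/
def RootedMap.relabel {p n : ℕ} (θ : Equiv.Perm (Fin (n * p))) (b : RootedMap p n) :
    RootedMap p n where
  map := b.map.relabel θ
  root := θ b.root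
  regular := b.regular.relabel θ
  connected := by
    have : Nonempty (Fin (n * p)) := ⟨b.root⟩
    exact CombMap.connected_relabel b.connected θ

theorem RootedMap.relabel_injective {p n : ℕ} (b : RootedMap p n) :
    Function.Injective fun θ => b.relabel θ := by
  intro θ η h
  have h1 : b.map.relabel θ = b.map.relabel η := congrArg RootedMap.map h
  have h2 : θ b.root = η b.root := congrArg RootedMap.root h
  have h3 := (CombMap.isRelabelling_relabel θ b.map)
  rw [h1] at h3
  have h4 := h3.trans (CombMap.isRelabelling_relabel η b.map).symm
  have h5 := h4.eq_one b.connected (r := b.root) (by simp [h2])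
  exact (inv_mul_eq_one.1 h5).symm

open Classical in
-- Relabellings act freely on rooted connected maps by `RootedMap.relabel_injective`, so each class
-- has (np)! elements, all with the same trace.
theorem sum_unlabelledMap {p n N : ℕ} (T : SymTensor p N) :
    ((n * p).factorial : ℝ) * ∑ b : UnlabelledMap p n, b.trace T =
      ∑ b : RootedMap p n, b.map.trace T := by
  let π : RootedMap p n → UnlabelledMap p n := Quotient.mk (RootedMap.setoid p n)
  rw [← Finset.sum_fiberwise Finset.univ π, Finset.mul_sum]
  refine Finset.sum_congr rfl fun q _ => ?_
  obtain ⟨b, rfl⟩ : ∃ b, π b = q := Quotient.exists_rep q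
  have h1 : (Finset.univ.filter fun c => π c = π b) =
      Finset.univ.image fun θ => b.relabel θ := by
    ext c
    simp only [Finset.mem_filter, Finset.mem_univ, true_and, Finset.mem_image]
    constructor
    · intro h
      obtain ⟨θ, hθ, hr⟩ : (RootedMap.setoid p n).r b c :=
        (RootedMap.setoid p n).symm (Quotient.exact h)
      refine ⟨θ, RootedMap.ext ?_ hr⟩
      obtain ⟨c, r, hc1, hc2⟩ := c
      obtain ⟨σ, τ, h1, h2⟩ := c
      obtain ⟨e1, e2⟩ := hθ
      simp only [RootedMap.relabel, CombMap.relabel, CombMap.mk.injEq]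
      exact ⟨e1.symm, e2.symm⟩
    · rintro ⟨θ, rfl⟩
      refine Quotient.sound ((RootedMap.setoid p n).symm ?_)
      exact ⟨θ, CombMap.isRelabelling_relabel θ b.map, rfl⟩
  have h2 : ∀ c ∈ Finset.univ.filter fun c => π c = π b, c.map.trace T = b.map.trace T := by
    intro c hc
    rw [h1] at hc
    obtain ⟨θ, -, rfl⟩ := Finset.mem_image.1 hc
    exact (CombMap.trace_eq_of_isRelabelling b.regular
      (CombMap.isRelabelling_relabel θ b.map) T).symm
  rw [Finset.sum_congr rfl h2, Finset.sum_const, h1,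
    Finset.card_image_of_injective _ b.relabel_injective, Finset.card_univ, Fintype.card_perm,
    Fintype.card_fin, nsmul_eq_mul]
  rfl

open Classical in
-- The summand does not see the root, which can be any of the np halfedges.
theorem sum_rootedMap {p n : ℕ} (F : CombMap (Fin (n * p)) → ℝ) :
    ∑ b : RootedMap p n, F b.map = (n * p : ℕ) * ∑ σ : Equiv.Perm (Fin (n * p)),
      ∑ τ : Matching (Fin (n * p)), if (CombMap.ofMatching σ τ).IsRegular p ∧
        (CombMap.ofMatching σ τ).graph.Connected then F (CombMap.ofMatching σ τ) else 0 := by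
  have h1 : ((n * p : ℕ) : ℝ) * ∑ σ : Equiv.Perm (Fin (n * p)),
      ∑ τ : Matching (Fin (n * p)), (if (CombMap.ofMatching σ τ).IsRegular p ∧
        (CombMap.ofMatching σ τ).graph.Connected then F (CombMap.ofMatching σ τ) else 0) =
      ∑ x : Fin (n * p) × Equiv.Perm (Fin (n * p)) × Matching (Fin (n * p)),
        if (CombMap.ofMatching x.2.1 x.2.2).IsRegular p ∧
        (CombMap.ofMatching x.2.1 x.2.2).graph.Connected then
        F (CombMap.ofMatching x.2.1 x.2.2) else 0 := by
    simp only [Fintype.sum_prod_type, Finset.sum_const, Finset.card_univ, Fintype.card_fin,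
      nsmul_eq_mul]
  rw [h1]
  refine Fintype.sum_of_injective (fun b : RootedMap p n => (b.root, b.map.σ, b.map.toMatching))
    ?_ _ _ ?_ ?_
  · intro b c h
    simp only [Prod.mk.injEq] at h
    refine RootedMap.ext ?_ h.1
    rw [← CombMap.ofMatching_toMatching b.map, ← CombMap.ofMatching_toMatching c.map, h.2.1, h.2.2]
  · rintro ⟨r, σ, τ⟩ hx
    refine if_neg fun h => hx ⟨⟨CombMap.ofMatching σ τ, r, h.1, h.2⟩, rfl⟩
  · intro b
    simp only [CombMap.ofMatching_toMatching]
    rw [if_pos ⟨b.regular, b.connected⟩]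

end

/-! ### Traces as sums over arrays; counting regular permutations. -/

section

variable {Q : Type}

namespace CombMap

theorem eq_or_eq_of_sameCycle_τ (b : CombMap Q) (q q' : Q) :
    b.τ.SameCycle q q' → q' = q ∨ q' = b.τ q := by
  have key : ∀ m : ℕ, (b.τ ^ m) q = q ∨ (b.τ ^ m) q = b.τ q := by
    intro m
    induction m with
    | zero => exact Or.inl rfl
    | succ m ih =>
      rw [pow_succ', Equiv.Perm.mul_apply]
      rcases ih with h | h
      · exact Or.inr (by rw [h])
      · exact Or.inl (by rw [h, b.τ_invol])
  have hinv : b.τ⁻¹ = b.τ := by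
    ext q
    rw [Equiv.Perm.inv_eq_iff_eq, b.τ_invol]
  rintro ⟨m, rfl⟩
  obtain ⟨m, rfl | rfl⟩ := m.eq_nat_or_neg
  · exact key m
  · rw [zpow_neg, ← inv_zpow, hinv]
    exact key m

open Classical in
theorem trace_eq_sum [Fintype Q] {p N : ℕ} (b : CombMap Q) (T : SymTensor p N) :
    b.trace T = ∑ a : Q → Fin N, if b.toMatching.Preserves a then
      ∏ v : b.Vertex, T.1 fun k : Fin p => a ((b.σ ^ (k : ℕ)) (b.rep v)) else 0 := by
  unfold trace
  refine @Fintype.sum_of_injective _ _ _ (_) (_) _ (fun a : b.Edge → Fin N => a ∘ b.edgeOf)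
    ?_ _ _ ?_ ?_
  · intro a a' h
    refine funext fun e => ?_
    obtain ⟨q, rfl⟩ := Quotient.exists_rep e
    exact congrFun h q
  · intro a ha
    refine if_neg fun h => ha ⟨Quotient.lift a fun q q' hq => ?_, rfl⟩
    rcases b.eq_or_eq_of_sameCycle_τ q q' hq with rfl | rfl
    · rfl
    · exact (h q).symm
  · intro a
    rw [if_pos]
    · rfl
    · intro q
      refine congrArg a (Quotient.sound (s := Equiv.Perm.SameCycle.setoid b.τ) ?_)
      change b.τ.SameCycle (b.τ q) q
      rw [Equiv.Perm.sameCycle_apply_left]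

end CombMap

/-- The cycles of a permutation. -/
def Cycles (σ : Equiv.Perm Q) : Type := Quotient (Equiv.Perm.SameCycle.setoid σ)

instance [Finite Q] (σ : Equiv.Perm Q) : Fintype (Cycles σ) :=
  @Fintype.ofFinite _ (inferInstanceAs (Finite (Quotient (Equiv.Perm.SameCycle.setoid σ))))

/-- The cycle of a point. -/
def Cycles.mk (σ : Equiv.Perm Q) (q : Q) : Cycles σ :=
  Quotient.mk (Equiv.Perm.SameCycle.setoid σ) q

/-- A point of a cycle. -/
def Cycles.out {σ : Equiv.Perm Q} (v : Cycles σ) : Q :=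
  @Quotient.out _ (Equiv.Perm.SameCycle.setoid σ) v

theorem Cycles.mk_out {σ : Equiv.Perm Q} (v : Cycles σ) : Cycles.mk σ v.out = v :=
  @Quotient.out_eq _ (Equiv.Perm.SameCycle.setoid σ) v

theorem Cycles.mk_eq_iff {σ : Equiv.Perm Q} {q q' : Q} :
    Cycles.mk σ q = Cycles.mk σ q' ↔ σ.SameCycle q q' :=
  ⟨fun h => Quotient.exact h, fun h => Quotient.sound (s := Equiv.Perm.SameCycle.setoid σ) h⟩

theorem Cycles.mk_pow {σ : Equiv.Perm Q} (v : Cycles σ) (m : ℕ) :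
    Cycles.mk σ ((σ ^ m) v.out) = v := by
  rw [← v.mk_out, Cycles.mk_eq_iff, Equiv.Perm.sameCycle_pow_left, v.mk_out]

/-- The points of a permutation all of whose cycles have length `p`, arranged into rows. -/
def cyclesProdEquiv [Finite Q] {p : ℕ} (hp : 0 < p) {σ : Equiv.Perm Q}
    (hσ : ∀ q, Function.minimalPeriod σ q = p) : Cycles σ × Fin p ≃ Q :=
  Equiv.ofBijective (fun x => (σ ^ (x.2 : ℕ)) x.1.out) (by
    constructor
    · rintro ⟨v, j⟩ ⟨v', j'⟩ h
      simp only at h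
      have hv : v = v' := by
        have := congrArg (Cycles.mk σ) h
        rwa [Cycles.mk_pow, Cycles.mk_pow] at this
      subst hv
      have hj : (j : ℕ) = j' := by
        rw [Equiv.Perm.coe_pow, Equiv.Perm.coe_pow] at h
        exact Function.iterate_injOn_Iio_minimalPeriod (f := σ) (x := v.out)
          (by simp [hσ]) (by simp [hσ]) h
      rw [Fin.ext hj]
    · intro q
      obtain ⟨m, hm⟩ := (Cycles.mk_eq_iff.1 (Cycles.mk_out (Cycles.mk σ q))).exists_nat_pow_eq
      refine ⟨(Cycles.mk σ q, ⟨m % p, Nat.mod_lt _ hp⟩), ?_⟩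
      have h := Function.iterate_mod_minimalPeriod_eq (f := σ) (x := (Cycles.mk σ q).out) (n := m)
      rw [hσ] at h
      simp only [Equiv.Perm.coe_pow] at hm ⊢
      rw [h, hm])

theorem card_cycles {n p : ℕ} (hp : 0 < p) {σ : Equiv.Perm (Fin (n * p))}
    (hσ : ∀ q, Function.minimalPeriod σ q = p) : Fintype.card (Cycles σ) = n := by
  have := Fintype.card_congr (cyclesProdEquiv hp hσ)
  rw [Fintype.card_prod, Fintype.card_fin, Fintype.card_fin] at this
  exact Nat.eq_of_mul_eq_mul_right hp this

open Classical in
-- Listing each cycle of `σ` from a chosen point turns halfedges into an array whose rows are the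
-- vertices, and edge labellings into labellings preserved by the matching.
theorem sum_trace_ofMatching [Fintype Q] [Nonempty Q] {p N : ℕ} (hp : 0 < p) {σ : Equiv.Perm Q}
    (hσ : ∀ q, Function.minimalPeriod σ q = p) (T : SymTensor p N) :
    (∑ τ : Matching Q, if (CombMap.ofMatching σ τ).graph.Connected then
      (CombMap.ofMatching σ τ).trace T else 0) =
      matchingSum fun a : Cycles σ × Fin p → Fin N => ∏ v, T.1 fun j => a (v, j) := by
  unfold matchingSum
  symm
  refine Fintype.sum_equiv (Matching.congr (cyclesProdEquiv hp hσ)) _ _ fun τ => ?_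
  have hc : (CombMap.ofMatching σ (Matching.congr (cyclesProdEquiv hp hσ) τ)).graph.Connected ↔
      τ.Connects Prod.fst := by
    rw [CombMap.connected_iff, CombMap.toMatching_ofMatching, Matching.congr_connects]
    have : (CombMap.ofMatching σ (Matching.congr (cyclesProdEquiv hp hσ) τ)).vertexOf ∘
        cyclesProdEquiv hp hσ = Prod.fst := by
      ext ⟨v, j⟩
      exact Cycles.mk_pow v j
    rw [this]
    rfl
  rw [CombMap.trace_eq_sum]
  simp only [hc]
  split_ifs with h
  · refine @Fintype.sum_equiv _ _ _ (_) (_) _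
      ((cyclesProdEquiv hp hσ).arrowCongr (Equiv.refl (Fin N))) _ _ fun a => ?_
    have h1 : ((cyclesProdEquiv hp hσ).arrowCongr (Equiv.refl (Fin N)) a) ∘
        cyclesProdEquiv hp hσ = a := by
      ext x; simp
    rw [CombMap.toMatching_ofMatching, Matching.congr_preserves, h1]
    simp only [h, true_and]
    congr 1
    refine Finset.prod_congr rfl fun v _ => congrArg T.1 (funext fun j => ?_)
    exact (congrFun h1 (v, j)).symm
  · simp [h]

section CycleType

variable [Fintype Q] [DecidableEq Q]

theorem card_support_cycleOf_eq_minimalPeriod (σ : Equiv.Perm Q) {q : Q} (hq : σ q ≠ q) :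
    (σ.cycleOf q).support.card = Function.minimalPeriod σ q := by
  have hc := Equiv.Perm.isCycle_cycleOf σ hq
  rw [← hc.orderOf]
  have key : ∀ m : ℕ, (σ.cycleOf q) ^ m = 1 ↔ Function.IsPeriodicPt σ m q := by
    intro m
    rw [hc.pow_eq_one_iff' (x := q) (by rwa [Equiv.Perm.cycleOf_apply_self]),
      Equiv.Perm.cycleOf_pow_apply_self, Function.IsPeriodicPt, Function.IsFixedPt,
      Equiv.Perm.coe_pow]
  refine Nat.dvd_antisymm ?_ ?_
  · exact orderOf_dvd_of_pow_eq_one ((key _).2 (Function.isPeriodicPt_minimalPeriod _ _))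
  · exact ((key _).1 (pow_orderOf_eq_one _)).minimalPeriod_dvd

/-- The cycle type ignores fixed points, hence the condition p ≥ 2; counting the support excludes
them. -/
theorem cycleType_eq_replicate_iff {n p : ℕ} (hp : 2 ≤ p) (hQ : Fintype.card Q = n * p)
    (σ : Equiv.Perm Q) :
    σ.cycleType = Multiset.replicate n p ↔ ∀ q, Function.minimalPeriod σ q = p := by
  constructor
  · intro h q
    have hsupp : σ.support = Finset.univ := by
      rw [← Finset.card_eq_iff_eq_univ, ← Equiv.Perm.sum_cycleType, h, Multiset.sum_replicate, hQ,
        smul_eq_mul]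
    have hq : σ q ≠ q := Equiv.Perm.mem_support.1 (hsupp ▸ Finset.mem_univ q)
    rw [← card_support_cycleOf_eq_minimalPeriod σ hq]
    refine Multiset.eq_of_mem_replicate (n := n) ?_
    rw [← h, Equiv.Perm.cycleType_def]
    refine Multiset.mem_map.2 ⟨σ.cycleOf q, ?_, rfl⟩
    exact Equiv.Perm.cycleOf_mem_cycleFactorsFinset_iff.2 (Equiv.Perm.mem_support.2 hq)
  · intro h
    have hne : ∀ q, σ q ≠ q := fun q hq => by
      have := h q
      rw [Function.minimalPeriod_eq_one_iff_isFixedPt.2 hq] at this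
      omega
    have hall : ∀ m ∈ σ.cycleType, m = p := by
      intro m hm
      rw [Equiv.Perm.cycleType_def] at hm
      obtain ⟨c, hc, rfl⟩ := Multiset.mem_map.1 hm
      obtain ⟨q, hq⟩ := (Equiv.Perm.mem_cycleFactorsFinset_iff.1 hc).1.nonempty_support
      have := Equiv.Perm.cycle_is_cycleOf hq hc
      rw [Function.comp_apply, this, card_support_cycleOf_eq_minimalPeriod σ (hne q), h]
    have hrep := Multiset.eq_replicate_card.2 hall
    have hsum := σ.sum_cycleType
    have hsupp : σ.support = Finset.univ := by
      ext q; simpa using hne q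
    rw [hrep, Multiset.sum_replicate, hsupp, Finset.card_univ, hQ, smul_eq_mul] at hsum
    rw [hrep, Nat.eq_of_mul_eq_mul_right (by omega) hsum]

end CycleType

open Classical in
/-- The number of permutations all of whose cycles have length `p`. -/
theorem card_regular_perm {n p : ℕ} (hp : 2 ≤ p) (hn : 0 < n) :
    (Finset.univ.filter fun σ : Equiv.Perm (Fin (n * p)) =>
      ∀ q, Function.minimalPeriod σ q = p).card * (p ^ n * n.factorial) = (n * p).factorial := by
  have h := Equiv.Perm.card_of_cycleType_mul_eq (Fin (n * p)) (Multiset.replicate n p)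
  rw [if_pos ⟨by simp, fun a ha => (Multiset.eq_of_mem_replicate ha).symm ▸ hp⟩] at h
  simp only [cycleType_eq_replicate_iff hp (Fintype.card_fin _), Multiset.sum_replicate,
    Fintype.card_fin, smul_eq_mul, Nat.sub_self, Nat.factorial_zero, one_mul,
    Multiset.prod_replicate, Multiset.toFinset_replicate, hn.ne', if_false,
    Finset.prod_singleton, Multiset.count_replicate_self] at h
  rw [← h]

end

/-! ### Normalization, expectation and the Fuss–Catalan constant. -/

section

open Classical in
/-- The permutations of `n * p` halfedges all of whose cycles have length `p`. -/
def regularPerms (n p : ℕ) : Finset (Equiv.Perm (Fin (n * p))) :=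
  Finset.univ.filter fun σ => ∀ q, Function.minimalPeriod σ q = p

theorem mem_regularPerms {n p : ℕ} {σ : Equiv.Perm (Fin (n * p))} :
    σ ∈ regularPerms n p ↔ ∀ q, Function.minimalPeriod σ q = p := by
  simp [regularPerms]

theorem balancedTrace_eq {n p N : ℕ} (hn : 0 < n) (hp : 0 < p) (T : SymTensor p N) :
    balancedTrace n T = ((n * p : ℕ) / (n * p).factorial : ℝ) * ∑ σ ∈ regularPerms n p,
      matchingSum fun a : Cycles σ × Fin p → Fin N => ∏ v, T.1 fun j => a (v, j) := by
  classical
  have hne : Nonempty (Fin (n * p)) := ⟨⟨0, Nat.mul_pos hn hp⟩⟩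
  have h1 := sum_unlabelledMap (n := n) T
  rw [sum_rootedMap fun b => b.trace T] at h1
  rw [balancedTrace, if_neg hn.ne', div_mul_eq_mul_div, eq_div_iff (by positivity), mul_comm, h1,
    regularPerms, Finset.sum_filter]
  congr 1
  refine Finset.sum_congr rfl fun σ _ => ?_
  split_ifs with hσ
  · rw [← sum_trace_ofMatching hp hσ]
    refine Finset.sum_congr rfl fun τ _ => ?_
    have : (CombMap.ofMatching σ τ).IsRegular p := hσ
    simp only [this, true_and]
  · refine Finset.sum_eq_zero fun τ _ => if_neg fun h => hσ h.1

theorem matchingSum_const_mul {V : Type} [Fintype V] {p N : ℕ} (c : ℝ)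
    (g : (V × Fin p → Fin N) → ℝ) : matchingSum (fun a => c * g a) = c * matchingSum g := by
  simp only [matchingSum, Finset.mul_sum, mul_ite, mul_zero]

theorem integrable_matchingSum {V : Type} {Ω : Type*} [Fintype V] {p N : ℕ} [MeasurableSpace Ω]
    {P : Measure Ω} {g : Ω → (V × Fin p → Fin N) → ℝ}
    (hg : ∀ a, Integrable (fun ω => g ω a) P) : Integrable (fun ω => matchingSum (g ω)) P := by
  classical
  refine integrable_finsetSum _ fun τ _ => integrable_finsetSum _ fun a _ => ?_
  split_ifs
  · exact hg a
  · exact integrable_zero _ _ _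

theorem integral_matchingSum {V : Type} {Ω : Type*} [Fintype V] {p N : ℕ} [MeasurableSpace Ω]
    {P : Measure Ω} {g : Ω → (V × Fin p → Fin N) → ℝ}
    (hg : ∀ a, Integrable (fun ω => g ω a) P) :
    ∫ ω, matchingSum (g ω) ∂P = matchingSum fun a => ∫ ω, g ω a ∂P := by
  classical
  have h1 : ∀ (τ : Matching (V × Fin p)) (a : V × Fin p → Fin N), Integrable
      (fun ω => if τ.Connects Prod.fst ∧ τ.Preserves a then g ω a else 0) P := by
    intro τ a
    split_ifs
    · exact hg a
    · exact integrable_zero _ _ _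
  unfold matchingSum
  rw [integral_finsetSum _ fun τ _ => integrable_finsetSum _ fun a _ => h1 τ a]
  refine Finset.sum_congr rfl fun τ _ => ?_
  rw [integral_finsetSum _ fun a _ => h1 τ a]
  refine Finset.sum_congr rfl fun a _ => ?_
  split_ifs
  · rfl
  · simp

theorem balancedTrace_normalize {n p N : ℕ} (hn : 0 < n) (hp : 0 < p) (T : SymTensor p N) :
    balancedTrace n (normalize T) = ((n * p : ℕ) / (n * p).factorial : ℝ) *
      (((N : ℝ) ^ (((p : ℝ) - 1) / 2))⁻¹ ^ n * ∑ σ ∈ regularPerms n p,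
      matchingSum fun a : Cycles σ × Fin p → Fin N => ∏ v, T.1 fun j => a (v, j)) := by
  rw [balancedTrace_eq hn hp]
  congr 1
  rw [Finset.mul_sum]
  refine Finset.sum_congr rfl fun σ hσ => ?_
  rw [← matchingSum_const_mul]
  congr 1
  ext a
  have h1 : ((N : ℝ) ^ (((p : ℝ) - 1) / 2))⁻¹ ^ n =
      ∏ _v : Cycles σ, ((N : ℝ) ^ (((p : ℝ) - 1) / 2))⁻¹ := by
    rw [Finset.prod_const, Finset.card_univ, card_cycles hp (mem_regularPerms.1 hσ)]
  rw [h1, ← Finset.prod_mul_distrib]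
  rfl

theorem nonempty_cycles {n p : ℕ} (hn : 0 < n) (hp : 0 < p) (σ : Equiv.Perm (Fin (n * p))) :
    Nonempty (Cycles σ) := ⟨Cycles.mk σ ⟨0, Nat.mul_pos hn hp⟩⟩

theorem HasWignerEntries.integrable_matchingSum {Ω : Type*} [MeasurableSpace Ω] {n p N : ℕ}
    {P : Measure Ω} {T : Ω → SymTensor p N} (h : HasWignerEntries P T) (hn : 0 < n) (hp : 0 < p)
    (σ : Equiv.Perm (Fin (n * p))) : Integrable (fun ω => matchingSum
      fun a : Cycles σ × Fin p → Fin N => ∏ v, (T ω).1 fun j => a (v, j)) P :=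
  have := nonempty_cycles hn hp σ
  WignerTensor.integrable_matchingSum fun _ => h.integrable_prod _

theorem HasWignerEntries.integrable_balancedTrace {Ω : Type*} [MeasurableSpace Ω] {n p N : ℕ}
    {P : Measure Ω} {T : Ω → SymTensor p N} (h : HasWignerEntries P T) (hn : 0 < n)
    (hp : 0 < p) : Integrable (fun ω => balancedTrace n (normalize (T ω))) P := by
  simp only [balancedTrace_normalize hn hp]
  exact ((integrable_finsetSum _ fun σ _ => h.integrable_matchingSum hn hp σ).const_mul _).const_mul _

theorem HasWignerEntries.integral_balancedTrace {Ω : Type*} [MeasurableSpace Ω] {n p N : ℕ}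
    {P : Measure Ω} {T : Ω → SymTensor p N} (h : HasWignerEntries P T) (hn : 0 < n)
    (hp : 0 < p) : ∫ ω, balancedTrace n (normalize (T ω)) ∂P =
      ((n * p : ℕ) / (n * p).factorial : ℝ) *
      (((N : ℝ) ^ (((p : ℝ) - 1) / 2))⁻¹ ^ n * ∑ σ ∈ regularPerms n p,
      matchingSum fun a : Cycles σ × Fin p → Fin N =>
        ∫ ω, ∏ v, (T ω).1 (fun j => a (v, j)) ∂P) := by
  simp only [balancedTrace_normalize hn hp]
  rw [integral_const_mul, integral_const_mul,
    integral_finsetSum _ fun σ _ => h.integrable_matchingSum hn hp σ]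
  congr 2
  refine Finset.sum_congr rfl fun σ _ => ?_
  have := nonempty_cycles hn hp σ
  exact integral_matchingSum fun _ => h.integrable_prod _

theorem blockSize_fst {k p : ℕ} (i : Fin k) :
    blockSize (Prod.fst : Fin k × Fin p → Fin k) i = p := by
  classical
  let e : {x : Fin k × Fin p // x.1 = i} ≃ Fin p :=
    { toFun := fun x => x.1.2
      invFun := fun j => ⟨(i, j), rfl⟩
      left_inv := by rintro ⟨⟨_, j⟩, rfl⟩; rfl
      right_inv := fun _ => rfl }
  rw [blockSize]
  exact congrArg Nat.cast (by convert Fintype.card_congr e; simp)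

/-- The Fuss–Catalan numbers in terms of the numbers of matchings and of permutations. -/
theorem fussCatalan_eq {k p : ℕ} (hk : 0 < k) (hp : 2 ≤ p) {D M : ℝ}
    (hD : D * (p ^ (2 * k) * (2 * k).factorial) = (2 * k * p).factorial)
    (hM : M * (2 ^ k * k.factorial) = (2 * k).factorial) :
    ((2 * k * p : ℕ) / (2 * k * p).factorial : ℝ) * (D * ((1 / ((p - 1).factorial : ℝ)) ^ k *
      (M * (p.factorial : ℝ) ^ k * blockCoeff (Prod.fst : Fin k × Fin p → Fin k)))) =
      fussCatalan p k := by
  have hp0 : (p : ℝ) ≠ 0 := by positivity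
  have hpf : (p.factorial : ℝ) = p * ((p - 1).factorial : ℝ) := by
    exact_mod_cast (Nat.mul_factorial_pred (by omega)).symm
  have hf0 : ((p - 1).factorial : ℝ) ≠ 0 := by positivity
  have hk0 : (k.factorial : ℝ) ≠ 0 := by positivity
  have h2k0 : ((2 * k).factorial : ℝ) ≠ 0 := by positivity
  have h2 : (1 / ((p - 1).factorial : ℝ)) ^ k * (p.factorial : ℝ) ^ k = (p : ℝ) ^ k := by
    rw [← mul_pow, hpf]
    congr 1
    field_simp
  have hD' : D = (2 * k * p).factorial / (p ^ (2 * k) * (2 * k).factorial) := by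
    rw [eq_div_iff (by positivity), hD]
  have hM' : M = (2 * k).factorial / (2 ^ k * k.factorial) := by
    rw [eq_div_iff (by positivity), hM]
  have h3 : ((2 * k * p).factorial : ℝ) ≠ 0 := by positivity
  -- `D` counts the regular permutations and `M` the pairings of the 2k rows; their factorials
  -- cancel, and so do those of the variance against the alignments.
  have h4 : ((2 * k * p : ℕ) / (2 * k * p).factorial : ℝ) *
      (D * ((1 / ((p - 1).factorial : ℝ)) ^ k *
      (M * (p.factorial : ℝ) ^ k * blockCoeff (Prod.fst : Fin k × Fin p → Fin k)))) =
      2 * k * p * blockCoeff (Prod.fst : Fin k × Fin p → Fin k) /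
        ((p : ℝ) ^ k * 2 ^ k * k.factorial) := by
    rw [show (1 / ((p - 1).factorial : ℝ)) ^ k * (M * (p.factorial : ℝ) ^ k *
      blockCoeff (Prod.fst : Fin k × Fin p → Fin k)) =
      ((1 / ((p - 1).factorial : ℝ)) ^ k * (p.factorial : ℝ) ^ k) * (M *
      blockCoeff (Prod.fst : Fin k × Fin p → Fin k)) by ring, h2, hD', hM']
    push_cast
    field_simp
    ring
  have h5 : fussCatalan p k = ((p * k).descFactorial (k - 1) : ℝ) / k.factorial := by
    obtain ⟨t, rfl⟩ : ∃ t, k = t + 1 := ⟨k - 1, by omega⟩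
    have h6 : (t + 1).factorial * (p * (t + 1) + 1).choose (t + 1) =
        (p * (t + 1) + 1) * (p * (t + 1)).descFactorial t := by
      rw [← Nat.descFactorial_eq_factorial_mul_choose, Nat.succ_descFactorial_succ]
    have h7 : ((t + 1).factorial : ℝ) * ((p * (t + 1) + 1).choose (t + 1) : ℝ) =
        (p * ((t + 1 : ℕ) : ℝ) + 1) * ((p * (t + 1)).descFactorial t : ℝ) := by
      exact_mod_cast h6
    have h8 : (p * ((t + 1 : ℕ) : ℝ) + 1) ≠ 0 := by positivity
    rw [fussCatalan, Nat.add_sub_cancel, eq_div_iff hk0]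
    field_simp
    linarith
  rw [h4, h5]
  -- The value k = 1 is the exceptional single-block case of `blockCoeff`. Otherwise the factor pk
  -- is absorbed into the falling factorial of pk - 1.
  obtain rfl | ⟨t, rfl⟩ : k = 1 ∨ ∃ t, k = t + 2 := by
    rcases k with _ | _ | t
    · omega
    · exact Or.inl rfl
    · exact Or.inr ⟨t, rfl⟩
  · simp [blockCoeff]
    field_simp
  · simp only [blockCoeff, Fintype.card_prod, Fintype.card_fin, blockSize_fst, Finset.prod_const,
      Finset.card_univ]
    rw [if_neg (by omega), show t + 2 - 1 = t + 1 from rfl, show t + 2 - 2 = t from rfl]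
    obtain ⟨m, hm⟩ : ∃ m, p * (t + 2) = m + 1 := ⟨p * (t + 2) - 1, by
      have : 0 < p * (t + 2) := by positivity
      omega⟩
    have hm' : (p : ℝ) * ((t + 2 : ℕ) : ℝ) = m + 1 := by exact_mod_cast hm
    rw [show (t + 2) * p - 1 = m by rw [mul_comm, hm]; rfl, hm, Nat.succ_descFactorial_succ]
    push_cast at hm' ⊢
    rw [← hm']
    field_simp
    ring

theorem inv_rpow_pow_two_mul {p k N : ℕ} (hp : 1 ≤ p) :
    ((N : ℝ) ^ (((p : ℝ) - 1) / 2))⁻¹ ^ (2 * k) = ((N : ℝ) ^ (k * (p - 1)))⁻¹ := by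
  rw [inv_pow, ← Real.rpow_mul_natCast (by positivity), ← Real.rpow_natCast]
  congr 2
  push_cast [Nat.cast_sub hp]
  ring

theorem isBigO_inv_of_isBigO_pow {f : ℕ → ℝ} {A : ℝ} {R : ℕ}
    (h : (fun N : ℕ => f N - A * (N : ℝ) ^ (R + 1)) =O[atTop] fun N : ℕ => (N : ℝ) ^ R) :
    (fun N : ℕ => 1 / (N : ℝ) * (((N : ℝ) ^ R)⁻¹ * f N) - A) =O[atTop] fun N : ℕ => 1 / (N : ℝ) := by
  have h1 := (isBigO_refl (fun N : ℕ => ((N : ℝ) ^ (R + 1))⁻¹) atTop).mul h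
  refine h1.congr' ?_ ?_
  · filter_upwards [eventually_ge_atTop 1] with N hN
    have : (N : ℝ) ≠ 0 := by positivity
    field_simp
    ring
  · filter_upwards [eventually_ge_atTop 1] with N hN
    have : (N : ℝ) ≠ 0 := by positivity
    field_simp
    ring

end

end WignerTensor

end

/-! ### Convergence of the expected balanced traces. -/

open WignerTensor in
theorem theorem1 (p : ℕ) (hp : 2 ≤ p) {Ω : ℕ → Type*} [∀ N, MeasurableSpace (Ω N)]
    (P : ∀ N, Measure (Ω N)) [∀ N, IsProbabilityMeasure (P N)]
    (W : ∀ N, Ω N → WignerTensor.SymTensor p N) (hW : WignerTensor.IsWignerSequence P W)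
    (n : ℕ) :
    (∀ N : ℕ, 1 ≤ N →
      Integrable (fun ω => 1 / (N : ℝ) * WignerTensor.balancedTrace n (W N ω)) (P N)) ∧
    (fun N : ℕ => (∫ ω, 1 / (N : ℝ) * WignerTensor.balancedTrace n (W N ω) ∂(P N)) -
        (if Even n then WignerTensor.fussCatalan p (n / 2) else 0))
      =O[atTop] fun N : ℕ => 1 / (N : ℝ) := by
  obtain ⟨T, hT, hC, hWT⟩ := hW
  have hp0 : 0 < p := by omega
  rcases Nat.eq_zero_or_pos n with rfl | hn
  · have h1 : ∀ N : ℕ, 1 ≤ N → ∀ ω, 1 / (N : ℝ) * balancedTrace 0 (W N ω) = 1 := by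
      intro N hN ω
      have : (N : ℝ) ≠ 0 := by positivity
      simp [balancedTrace, this]
    refine ⟨fun N hN => by simp only [h1 N hN]; exact integrable_const _, ?_⟩
    refine (isBigO_zero _ _).congr' ?_ EventuallyEq.rfl
    filter_upwards [eventually_ge_atTop 1] with N hN
    simp only [h1 N hN]
    simp [fussCatalan]
  refine ⟨fun N hN => ?_, ?_⟩
  · simp only [hWT N hN]
    exact ((hT N hN).integrable_balancedTrace hn hp0).const_mul _
  have hmean : ∀ N : ℕ, 1 ≤ N → ∫ ω, 1 / (N : ℝ) * balancedTrace n (W N ω) ∂(P N) =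
      ((n * p : ℕ) / (n * p).factorial : ℝ) * (1 / (N : ℝ) *
      (((N : ℝ) ^ (((p : ℝ) - 1) / 2))⁻¹ ^ n * ∑ σ ∈ regularPerms n p,
      matchingSum fun a : Cycles σ × Fin p → Fin N =>
        ∫ ω, ∏ v, (T N ω).1 (fun j => a (v, j)) ∂(P N))) := by
    intro N hN
    simp only [hWT N hN]
    rw [integral_const_mul, (hT N hN).integral_balancedTrace hn hp0]
    ring
  have hmom : ∀ σ : Equiv.Perm (Fin (n * p)), IsMomentLike (V := Cycles σ)
      (1 / ((p - 1).factorial : ℝ)) fun N a =>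
      ∫ ω, ∏ v, (T N ω).1 (fun j => a (v, j)) ∂(P N) := fun σ =>
    have := nonempty_cycles hn hp0 σ
    isMomentLike_integral_prod hT hC
  rcases Nat.even_or_odd' n with ⟨k, rfl | rfl⟩
  · rw [if_pos (even_two_mul k), Nat.mul_div_cancel_left k two_pos]
    have hk : 0 < k := by omega
    obtain ⟨M, hM'⟩ : ∃ M : ℝ, M = Fintype.card (Matching (Fin (2 * k))) := ⟨_, rfl⟩
    have hM : M * (2 ^ k * k.factorial) = (2 * k).factorial := by
      rw [hM']
      exact_mod_cast Matching.card_mul (Y := Fin (2 * k)) k (Fintype.card_fin _)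
    have hsum := IsBigO.fun_sum fun σ (hσ : σ ∈ regularPerms (2 * k) p) =>
      (hmom σ).isBigO_of_even hp hk (card_cycles hp0 (mem_regularPerms.1 hσ))
    have hcard : ∀ σ ∈ regularPerms (2 * k) p,
        (Fintype.card (Matching (Cycles σ)) : ℝ) = M := by
      intro σ hσ
      have e : Cycles σ ≃ Fin (2 * k) :=
        Fintype.equivFinOfCardEq (card_cycles hp0 (mem_regularPerms.1 hσ))
      rw [hM', Fintype.card_congr (Matching.congr e)]
    set A : ℝ := (1 / ((p - 1).factorial : ℝ)) ^ k * (M * (p.factorial : ℝ) ^ k *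
      blockCoeff (Prod.fst : Fin k × Fin p → Fin k)) with hA
    have h1 : (fun N : ℕ => ∑ σ ∈ regularPerms (2 * k) p,
        (matchingSum fun a : Cycles σ × Fin p → Fin N =>
          ∫ ω, ∏ v, (T N ω).1 (fun j => a (v, j)) ∂(P N)) -
        ((regularPerms (2 * k) p).card * A) * (N : ℝ) ^ (k * (p - 1) + 1)) =O[atTop]
        fun N : ℕ => (N : ℝ) ^ (k * (p - 1)) := by
      refine hsum.congr_left fun N => ?_
      rw [Finset.sum_sub_distrib]
      congr 1
      rw [Finset.sum_congr rfl fun σ hσ => by rw [hcard σ hσ], Finset.sum_const, nsmul_eq_mul]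
      ring
    have h2 := (isBigO_inv_of_isBigO_pow h1).const_mul_left
      ((2 * k * p : ℕ) / (2 * k * p).factorial : ℝ)
    refine h2.congr' ?_ EventuallyEq.rfl
    filter_upwards [eventually_ge_atTop 1] with N hN
    have hD := card_regular_perm (n := 2 * k) hp hn
    rw [hmean N hN, inv_rpow_pow_two_mul (by omega), mul_sub, hA,
      fussCatalan_eq hk hp (by exact_mod_cast hD) hM]
  · rw [if_neg (by simp)]
    have hsum := IsBigO.fun_sum fun σ (hσ : σ ∈ regularPerms (2 * k + 1) p) =>
      (hmom σ).isBigO_of_odd hp (card_cycles hp0 (mem_regularPerms.1 hσ))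
    -- For n = 2k + 1 the normalization is N^{-k(p-1)} times this factor. Boundedness of the factor
    -- is enough, since the sum is already O(N^{k(p-1)}), treated below as having leading
    -- coefficient 0.
    have h1 : (fun N : ℕ => ((N : ℝ) ^ (((p : ℝ) - 1) / 2))⁻¹) =O[atTop]
        fun _ : ℕ => (1 : ℝ) := by
      refine IsBigO.of_bound 1 ?_
      filter_upwards [eventually_ge_atTop 1] with N hN
      have hN' : (1 : ℝ) ≤ N := by exact_mod_cast hN
      have hp' : (2 : ℝ) ≤ p := by exact_mod_cast hp
      rw [norm_one, mul_one, Real.norm_of_nonneg (by positivity)]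
      exact inv_le_one_of_one_le₀ (Real.one_le_rpow hN' (by linarith))
    have h2 : (fun N : ℕ => ∑ σ ∈ regularPerms (2 * k + 1) p,
        (matchingSum fun a : Cycles σ × Fin p → Fin N =>
          ∫ ω, ∏ v, (T N ω).1 (fun j => a (v, j)) ∂(P N)) - 0 * (N : ℝ) ^ (k * (p - 1) + 1))
        =O[atTop] fun N : ℕ => (N : ℝ) ^ (k * (p - 1)) := by
      simpa using hsum
    have h3 := (h1.mul (isBigO_inv_of_isBigO_pow h2)).const_mul_left
      (((2 * k + 1) * p : ℕ) / ((2 * k + 1) * p).factorial : ℝ)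
    refine h3.congr' ?_ ?_
    · filter_upwards [eventually_ge_atTop 1] with N hN
      rw [hmean N hN, pow_succ, inv_rpow_pow_two_mul (by omega)]
      ring
    · exact Eventually.of_forall fun N => by simp
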